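/- Let $C$ be a finite set of $m$ candidates and $V=(v_1,\dots,v_n)$ a profile of linear orders on $C$ (the sincere votes). Under Plurality each voter gives one point to the top candidate of her vote; the winner $\mathcal R_1(V)$ is the candidate with the highest score, ties being broken by a given linear order $>$ on $C$. For a voter $i$ let $F_i=\{\mathcal R_1(V_{-i},v') : v' \text{ a linear order on } C\}$. Voter $i$ is a GS-manipulator if she strictly prefers (according to $v_i$) some candidate in $F_i$ to $\mathcal R_1(V)$, and $v'_i$ is a level-1 strategy of voter $i$ if $\mathcal R_1(V_{-i},v'_i)$ is her most preferred candidate in $F_i$. A GS-game under Plurality is the following normal-form game: the players are voter $1$ and all GS-manipulators; the strategies of voter $1$ are all linear orders on $C$; the strategy set $A_i$ of every other player $i$ consists of $v_i$ and a (possibly empty) subset of the level-1 strategies of $i$; players compare strategy profiles, according to their sincere votes, by the Plurality winner of the election in which the players submit their strategies and all other voters vote truthfully. A strategy $v'$ of voter $1$ weakly dominates $v''$ if, for every choice of the strategies of the other players, voter $1$ finds the outcome of $v'$ at least as good as that of $v''$, and for some choice she finds it strictly better. Theorem. There is a polynomial-time algorithm that, given a GS-game under Plurality (that is, the profile $V$,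 the tie-breaking order and the sets $A_i$ of the players $i\neq 1$, listed explicitly) and two strategies $v_1', v_1''$ of player $1$, decides whether $v_1'$ weakly dominates $v_1''$. -/

import Mathlib

namespace GSVoting

/-! ### Votes, profiles and voting rules -/

/-- A linear order on the candidate set `Fin m`, written as a ranking: `v p` is the candidate in
position `p` (position `0` is the top) and `v.symm c` is the position of candidate `c`. -/
abbrev Vote (m : ℕ) := Equiv.Perm (Fin m)

/-- `a` is ranked strictly above `b` in `v`. -/
def Prefers {m : ℕ} (v : Vote m) (a b : Fin m) : Prop := v.symm a < v.symm b

/-- A preference profile of `n` voters over `m` candidates. -/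
abbrev Profile (n m : ℕ) := Fin n → Vote m

/-- A resolute voting rule. -/
abbrev VotingRule (n m : ℕ) := Profile n m → Fin m

/-- The `k`-approval score: the number of voters who rank `c` in one of the top `k` positions. -/
def score {n m : ℕ} (k : ℕ) (V : Profile n m) (c : Fin m) : ℕ :=
  (Finset.univ.filter fun i : Fin n => ((V i).symm c : ℕ) < k).card

/-- The positions, in the tie-breaking order `tb`, of the candidates with the highest score. -/
def topPositions {n m : ℕ} (k : ℕ) (tb : Vote m) (V : Profile n m) : Finset (Fin m) :=
  Finset.univ.filter fun p : Fin m => ∀ c : Fin m, score k V c ≤ score k V (tb p)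

theorem topPositions_nonempty {n m : ℕ} [NeZero m] (k : ℕ) (tb : Vote m) (V : Profile n m) :
    (topPositions k tb V).Nonempty := by
  obtain ⟨c, -, hc⟩ := Finset.exists_max_image (Finset.univ : Finset (Fin m)) (score k V)
    ⟨0, Finset.mem_univ _⟩
  refine ⟨tb.symm c, ?_⟩
  simp only [topPositions, Finset.mem_filter, Finset.mem_univ, true_and, Equiv.apply_symm_apply]
  exact fun d => hc d (Finset.mem_univ d)

/-- The `k`-approval rule: among the candidates with the highest `k`-approval score, the one that
is ranked highest by the tie-breaking order `tb` wins. -/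
def kApproval {n m : ℕ} [NeZero m] (k : ℕ) (tb : Vote m) : VotingRule n m := fun V =>
  tb ((topPositions k tb V).min' (topPositions_nonempty k tb V))

/-- Plurality is `1`-approval. -/
abbrev plurality {n m : ℕ} [NeZero m] (tb : Vote m) : VotingRule n m := kApproval 1 tb

/-! ### Manipulations and level-1 strategies -/

/-- `v'` is a manipulative vote of voter `i` at `V`. -/
def IsManipulativeVote {n m : ℕ} (R : VotingRule n m) (V : Profile n m) (i : Fin n)
    (v' : Vote m) : Prop :=
  Prefers (V i) (R (Function.update V i v')) (R V)

/-- Voter `i` is a Gibbard--Satterthwaite manipulator at `V`. -/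
def IsGSManipulator {n m : ℕ} (R : VotingRule n m) (V : Profile n m) (i : Fin n) : Prop :=
  ∃ v' : Vote m, IsManipulativeVote R V i v'

/-- The candidates that are feasible for voter `i` at `V`. -/
def feasible {n m : ℕ} (R : VotingRule n m) (V : Profile n m) (i : Fin n) : Set (Fin m) :=
  {c | ∃ v' : Vote m, R (Function.update V i v') = c}

/-- `v'` is a level-1 strategy of voter `i` at `V`: it makes the most preferred feasible candidate
of voter `i` the winner. -/
def IsLevelOne {n m : ℕ} (R : VotingRule n m) (V : Profile n m) (i : Fin n)
    (v' : Vote m) : Prop :=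
  ∀ c ∈ feasible R V i, c ≠ R (Function.update V i v') →
    Prefers (V i) (R (Function.update V i v')) c

/-! ### Normal-form games -/

/-- A normal-form game with ordinal preferences over strategy profiles. -/
structure NormalFormGame where
  Player : Type
  [decEqPlayer : DecidableEq Player]
  Strategy : Player → Type
  /-- `weakPref i s t` : player `i` finds the profile `s` at least as good as `t`. -/
  weakPref : Player → (∀ j, Strategy j) → (∀ j, Strategy j) → Prop

attribute [instance] NormalFormGame.decEqPlayer

/-- Strict preference of player `i`. -/
def NormalFormGame.StrictPref (G : NormalFormGame) (i : G.Player)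
    (s t : ∀ j, G.Strategy j) : Prop :=
  G.weakPref i s t ∧ ¬ G.weakPref i t s

/-- Strategy `a` of player `i` weakly dominates strategy `b`. The entry of `s` at `i` is
overwritten, so the quantifiers range over the strategy profiles of the other players. -/
def NormalFormGame.WeaklyDominates (G : NormalFormGame) (i : G.Player) (a b : G.Strategy i) :
    Prop :=
  (∀ s : ∀ j, G.Strategy j, G.weakPref i (Function.update s i a) (Function.update s i b)) ∧
  ∃ s : ∀ j, G.Strategy j, G.StrictPref i (Function.update s i a) (Function.update s i b)

/-! ### GS-games. The distinguished voter (voter 1 in the usual numbering) is `0 : Fin n`. -/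

/-- A GS-game for the rule `R`: a profile of sincere votes and, for every GS-manipulator other than
the distinguished voter, a set of strategies that consists of the truthful vote and a (possibly
empty) set of level-1 strategies. -/
structure GSGame {n m : ℕ} [NeZero n] (R : VotingRule n m) where
  profile : Profile n m
  strat : {i : Fin n // i ≠ 0 ∧ IsGSManipulator R profile i} → Finset (Vote m)
  truthful_mem : ∀ i, profile i.1 ∈ strat i
  level_one : ∀ i, ∀ v ∈ strat i, v ≠ profile i.1 → IsLevelOne R profile i.1 v

namespace GSGame

variable {n m : ℕ} [NeZero n] {R : VotingRule n m}

/-- The players are the GS-manipulators and the distinguished voter. -/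
def IsPlayer (G : GSGame R) (i : Fin n) : Prop := i = 0 ∨ IsGSManipulator R G.profile i

/-- The strategy sets; the distinguished voter may submit an arbitrary vote. -/
def strategies (G : GSGame R) (i : {i : Fin n // G.IsPlayer i}) : Set (Vote m) :=
  {v | ∀ h : i.1 ≠ 0, v ∈ G.strat ⟨i.1, h, i.2.resolve_left h⟩}

open Classical in
/-- The profile of submitted votes: players vote according to the strategy profile `s`, all other
voters vote truthfully. -/
noncomputable def outcomeProfile (G : GSGame R)
    (s : ∀ i : {i : Fin n // G.IsPlayer i}, G.strategies i) : Profile n m := fun i =>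
  if h : G.IsPlayer i then (s ⟨i, h⟩ : Vote m) else G.profile i

/-- The normal-form game of a GS-game: players compare strategy profiles by the winner, according to
their sincere preferences. -/
noncomputable def toNormalFormGame (G : GSGame R) : NormalFormGame where
  Player := {i : Fin n // G.IsPlayer i}
  Strategy := fun i => G.strategies i
  weakPref := fun i s t =>
    Prefers (G.profile i.1) (R (G.outcomeProfile s)) (R (G.outcomeProfile t)) ∨
      R (G.outcomeProfile s) = R (G.outcomeProfile t)

/-- The distinguished voter as a player. -/
def player1 (G : GSGame R) : {i : Fin n // G.IsPlayer i} := ⟨0, Or.inl rfl⟩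

/-- Every vote is a strategy of the distinguished voter. -/
def strategy1 (G : GSGame R) (v : Vote m) : G.strategies G.player1 :=
  ⟨v, fun h => absurd rfl h⟩

/-- The vote `u` of the distinguished voter weakly dominates the vote `v` in `G`. -/
def Dominates (G : GSGame R) (u v : Vote m) : Prop :=
  G.toNormalFormGame.WeaklyDominates G.player1 (G.strategy1 u) (G.strategy1 v)

end GSGame

/-! ### The decision problem and the encoding of its instances -/

/-- An instance: a GS-game under Plurality with tie-breaking order `tb`, whose strategy sets are
given explicitly (in any order), and two votes of the distinguished voter. -/
structure PluralityInstance where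
  n : ℕ
  m : ℕ
  [hn : NeZero n]
  [hm : NeZero m]
  tb : Vote m
  game : GSGame (n := n) (plurality tb)
  /-- the strategy sets of the players other than the distinguished voter, listed in some order -/
  listing : Fin n → List (Vote m)
  listing_player : ∀ i, (listing i.1).toFinset = game.strat i
  listing_nonplayer : ∀ i : Fin n,
    ¬ (i ≠ 0 ∧ IsGSManipulator (plurality tb) game.profile i) → listing i = []
  u : Vote m
  v : Vote m

attribute [instance] PluralityInstance.hn PluralityInstance.hm

/-- A vote is written as the list of the candidates, from top to bottom. -/
def encodeVote {m : ℕ} (v : Vote m) : List ℕ := List.ofFn fun p => (v p : ℕ)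

/-- A list of votes is written as its length followed by the votes. -/
def encodeVotes {m : ℕ} (L : List (Vote m)) : List ℕ := L.length :: L.flatMap encodeVote

/-- The instance as a list of natural numbers: `n`, `m`, the tie-breaking order, the sincere votes,
the lists of strategies (an empty list for every voter without a listed strategy set), and the two
votes that are to be compared. -/
def PluralityInstance.encode (I : PluralityInstance) : List ℕ :=
  [I.n, I.m] ++ encodeVote I.tb
    ++ (List.finRange I.n).flatMap (fun i => encodeVote (I.game.profile i))
    ++ (List.finRange I.n).flatMap (fun i => encodeVotes (I.listing i))
    ++ encodeVote I.u ++ encodeVote I.v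

/-! ### Polynomial time on a random access machine

The machine has registers and a memory, both indexed by and holding natural numbers. Its arithmetic
is addition and truncated subtraction only, so `t` steps produce numbers that are at most `t`
bits longer than the constants of the program and the numbers in the input, and unit cost per instruction yields the same
notion of polynomial time as Turing machines. -/

/-- Instructions; the arguments are register numbers, constants and jump targets. -/
inductive Instr where
  /-- `reg d := a` -/
  | const (d a : ℕ)
  /-- `reg d := reg r + reg s` -/
  | plus (d r s : ℕ)
  /-- `reg d := reg r - reg s` (truncated) -/
  | minus (d r s : ℕ)
  /-- `reg d := mem (reg r)` -/
  | load (d r : ℕ)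
  /-- `mem (reg r) := reg s` -/
  | store (r s : ℕ)
  /-- if `reg r > 0`, continue at instruction `l` -/
  | jumpPos (r l : ℕ)

/-- A configuration: program counter, registers, memory. -/
structure Config where
  pc : ℕ
  reg : ℕ → ℕ
  mem : ℕ → ℕ

/-- The effect of one instruction. -/
def Instr.exec : Instr → Config → Config
  | .const d a, c => { c with pc := c.pc + 1, reg := Function.update c.reg d a }
  | .plus d r s, c =>
    { c with pc := c.pc + 1, reg := Function.update c.reg d (c.reg r + c.reg s) }
  | .minus d r s, c =>
    { c with pc := c.pc + 1, reg := Function.update c.reg d (c.reg r - c.reg s) }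
  | .load d r, c => { c with pc := c.pc + 1, reg := Function.update c.reg d (c.mem (c.reg r)) }
  | .store r s, c => { c with pc := c.pc + 1, mem := Function.update c.mem (c.reg r) (c.reg s) }
  | .jumpPos r l, c => { c with pc := if 0 < c.reg r then l else c.pc + 1 }

/-- One step of the program `P`; outside the program the machine has halted and does not move. -/
def step (P : List Instr) (c : Config) : Config :=
  match P[c.pc]? with
  | some q => q.exec c
  | none => c

/-- The initial configuration on input `w`: the input is at the beginning of the memory, its length
is in register `0`, and everything else is zero. -/
def initConfig (w : List ℕ) : Config where
  pc := 0
  reg := fun r => if r = 0 then w.length else 0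
  mem := fun a => w.getD a 0

/-- On input `w` the program `P` halts after at most `t` steps with `out` in register `0`. -/
def HaltsWith (P : List Instr) (w : List ℕ) (t out : ℕ) : Prop :=
  P.length ≤ ((step P)^[t] (initConfig w)).pc ∧ ((step P)^[t] (initConfig w)).reg 0 = out

/-- The size of an input: the total number of bits, with one separator per number. -/
def inputSize (w : List ℕ) : ℕ := (w.map fun a => Nat.size a + 1).sum

/-- The property `Q` of instances, given through the encoding `enc`, is decidable in polynomial
time: one program answers `1` or `0` correctly on all instances, within a number of steps that is
polynomial in the size of the input. -/
def PolyTimeDecidable {α : Type} (enc : α → List ℕ) (Q : α → Prop) : Prop :=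
  ∃ (P : List Instr) (p : Polynomial ℕ), ∀ x : α,
    (Q x → HaltsWith P (enc x) (p.eval (inputSize (enc x))) 1) ∧
    (¬ Q x → HaltsWith P (enc x) (p.eval (inputSize (enc x))) 0)

end GSVoting

set_option linter.unusedSectionVars false

/-! Under Plurality only top candidates matter. All level-1 strategies of a manipulator elect the
same candidate, and that candidate is their common top. So every voter other than the distinguished
voter `0` has at most two options: the sincere top `t i` and one further candidate `c i`, with `c i
= t i` when there is no choice. As preferences are linear, `dominates_iff` reduces weak dominance to
two instances of one question: can the others vote so that a ballot for `a` elects some `x`, a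
ballot for `b` elects some `y`, and voter `0` prefers `y` to `x`? The candidates `x`, `y` and their
scores `X`, `Y` without this ballot can be enumerated. The winning conditions then become upper
bounds on the loads (`Compatible`), together with the demand that `x` and `y` have loads exactly `X`
and `Y`.

In general this is a flow problem, but here one augmenting path suffices. No voter with a real
choice supports the sincere winner `w` or can move to it, and every second option overtakes `w` with
one more vote (`SincereState`). Hence, once the loads have changed, a winner other than `w` reaches
at least the sincere level of `w` (`SincereState.winner_level`). It follows that the sincere loads
respect all bounds, except that the extra ballot may put `a ≠ x` or `b ≠ y` one vote above its
bound. Since both ballots meet the same loads, `a = x` or `b = y` (`eq_or_eq_of_wins`), so at most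
one bound is violated, and by one vote only.

The excess can be removed exactly if a candidate with slack is reachable by moves `t i → c i`. A
shortest path shifts one vote (`exists_reallocation`). If all reachable candidates are full,
counting votes on this closed set shows that no load on it can change (`load_eq_of_closed`). Finally
`x` and `y` are raised to `X` and `Y` by exchanges that increase no other load; Hall-type counts of
options are enough for this (`exists_load_eq`). `Criterion` collects the conditions, and
`Criterion.exists_admissible` and `SincereState.criterion` are its two directions.

The criterion consists of counts, comparisons and reachability over ranges bounded by the numbers of
voters and candidates. It is written in a small language with bounded sums and loops and compiled to
the machine. All iteration counts are read from three registers that no command modifies and that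
are at most the input length, so the number of steps is polynomial (`Expr.code_correct`,
`Cmd.code_correct`). -/

namespace GSVoting

open Finset

/-! ### Voters with two options: augmenting paths and prescribed loads. -/

section Reallocation

variable {ι C : Type*} [DecidableEq ι] [DecidableEq C]

/-- The number of voters of `I` that `h` assigns to `z`. -/
def load (I : Finset ι) (h : ι → C) (z : C) : ℕ := (I.filter fun i => h i = z).card

/-- Every voter of `I` is assigned to one of her two options. -/
def Admissible (I : Finset ι) (t c h : ι → C) : Prop := ∀ i ∈ I, h i = t i ∨ h i = c i

theorem Admissible.update {I : Finset ι} {t c h : ι → C} (hh : Admissible I t c h) {i : ι} {x : C}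
    (hx : t i = x ∨ c i = x) : Admissible I t c (Function.update h i x) := by
  intro j hj
  by_cases e : j = i
  · subst e
    simpa [eq_comm] using hx
  · simpa [e] using hh j hj

/-- Both sides are sums, so that no truncated subtraction occurs and `omega` can combine successive
moves. -/
theorem load_update {I : Finset ι} (h : ι → C) {i : ι} (hi : i ∈ I) (x z : C) :
    load I (Function.update h i x) z + (if h i = z then 1 else 0)
      = load I h z + (if x = z then 1 else 0) := by
  have key : ∀ g : ι → C, load I g z
      = (∑ j ∈ I.erase i, if g j = z then 1 else 0) + (if g i = z then 1 else 0) := by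
    intro g
    rw [load, card_filter, sum_erase_add _ _ hi]
  rw [key, key h]
  have : (∑ j ∈ I.erase i, if Function.update h i x j = z then 1 else 0)
      = ∑ j ∈ I.erase i, if h j = z then 1 else 0 :=
    sum_congr rfl fun j hj => by rw [Function.update_of_ne (ne_of_mem_erase hj)]
  rw [this, Function.update_self]
  omega

theorem sum_load [Fintype C] (I : Finset ι) (h : ι → C) : ∑ z, load I h z = I.card :=
  (card_eq_sum_card_fiberwise fun _ _ => mem_coe.2 (mem_univ _)).symm

theorem sum_load_subset (I : Finset ι) (h : ι → C) (U : Finset C) :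
    ∑ z ∈ U, load I h z = (I.filter fun i => h i ∈ U).card := by
  rw [card_eq_sum_card_fiberwise (f := h) (t := U) (fun i hi => by simpa using (mem_filter.1 hi).2)]
  refine sum_congr rfl fun z hz => ?_
  rw [load, filter_filter]
  congr 1
  ext i
  simp only [mem_filter]
  constructor
  · rintro ⟨hi, rfl⟩
    exact ⟨hi, hz, rfl⟩
  · rintro ⟨hi, -, e⟩
    exact ⟨hi, e⟩

/-- The loads have the same total, so they cannot differ without an increase somewhere. -/
theorem exists_load_lt [Fintype C] {I : Finset ι} {h t : ι → C} (hne : load I h ≠ load I t) :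
    ∃ z, load I t z < load I h z := by
  by_contra! hle
  apply hne
  have := (sum_eq_sum_iff_of_le (s := univ) (fun z _ => hle z)).1
    (by rw [sum_load, sum_load])
  exact funext fun z => this z (mem_univ z)

/-- A candidate gains votes only from voters who have it as a genuine second option. -/
theorem Admissible.exists_move {I : Finset ι} {h t c : ι → C} (hh : Admissible I t c h) {z : C}
    (hz : load I t z < load I h z) : ∃ i ∈ I, c i = z ∧ c i ≠ t i := by
  by_contra! hB
  refine absurd (card_le_card fun i hi => ?_) (not_le.2 hz)
  obtain ⟨hi, e⟩ := mem_filter.1 hi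
  refine mem_filter.2 ⟨hi, ?_⟩
  rcases hh i hi with h' | h'
  · exact h'.symm.trans e
  · exact (hB i hi (h'.symm.trans e)).symm.trans (h'.symm.trans e)

/-- The vertices that are reached from `v` in at most `k` moves. -/
def layer (I : Finset ι) (t c : ι → C) (v : C) : ℕ → Finset C
  | 0 => {v}
  | k + 1 => layer I t c v k ∪ (I.filter fun i => t i ∈ layer I t c v k).image c

variable {I : Finset ι} {t c : ι → C} {v : C}

theorem layer_subset_succ (k : ℕ) : layer I t c v k ⊆ layer I t c v (k + 1) := subset_union_left

theorem layer_mono {j k : ℕ} (h : j ≤ k) : layer I t c v j ⊆ layer I t c v k :=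
  monotone_nat_of_le_succ (f := layer I t c v) layer_subset_succ h

theorem mem_layer_succ_of_move {k : ℕ} {i : ι} (hi : i ∈ I) (h : t i ∈ layer I t c v k) :
    c i ∈ layer I t c v (k + 1) :=
  mem_union_right _ (mem_image_of_mem _ (mem_filter.2 ⟨hi, h⟩))

theorem layer_stable_of_eq {k : ℕ} (h : layer I t c v (k + 1) = layer I t c v k) (j : ℕ) :
    layer I t c v (k + j) = layer I t c v k := by
  induction j with
  | zero => rfl
  | succ j ih =>
    rw [← add_assoc, layer, ih, ← layer, h]

/-- The layers grow by at least one candidate per stage until they stop growing for good; hence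
`Fintype.card C` stages reach everything. -/
theorem lt_card_layer_or_stable (k : ℕ) :
    k < (layer I t c v k).card ∨ ∀ j, layer I t c v (k + j) = layer I t c v k := by
  induction k with
  | zero => left; simp [layer]
  | succ k ih =>
    rcases ih with ih | ih
    · by_cases e : layer I t c v (k + 1) = layer I t c v k
      · right
        intro j
        rw [e, add_assoc, add_comm 1 j, layer_stable_of_eq e]
      · left
        have := card_lt_card (lt_of_le_of_ne (layer_subset_succ k) (Ne.symm e))
        omega
    · right
      intro j
      rw [ih 1, add_assoc, ih]

theorem mem_layer_card [Fintype C] {k : ℕ} {s : C} (h : s ∈ layer I t c v k) :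
    s ∈ layer I t c v (Fintype.card C) := by
  rcases lt_card_layer_or_stable (I := I) (t := t) (c := c) (v := v) (Fintype.card C) with h' | h'
  · exact absurd (card_le_univ _) (not_le.2 h')
  · rw [← h' k]
    exact layer_mono (Nat.le_add_left _ _) h

/-- Along a shortest path from `v` to `s` every voter moves at most once, and the net effect is one
vote carried from `v` to `s`. The condition on the moved voters is what makes the induction work. -/
theorem exists_reallocation_of_mem_layer {k : ℕ} : ∀ {s : C}, s ∈ layer I t c v k →
    (∀ j < k, s ∉ layer I t c v j) →
    ∃ h, Admissible I t c h ∧ (∀ i ∈ I, h i ≠ t i → ∃ j < k, t i ∈ layer I t c v j) ∧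
      ∀ z, load I h z + (if v = z then 1 else 0) = load I t z + (if s = z then 1 else 0) := by
  induction k with
  | zero =>
    intro s hs _
    obtain rfl : s = v := by simpa [layer] using hs
    exact ⟨t, fun _ _ => Or.inl rfl, fun i _ hi => absurd rfl hi, fun _ => rfl⟩
  | succ k ih =>
    intro s hs hmin
    have hk := hmin k (Nat.lt_succ_self k)
    rw [layer, mem_union, mem_image] at hs
    obtain ⟨i, hi, rfl⟩ := hs.resolve_left hk
    obtain ⟨hiI, hik⟩ := mem_filter.1 hi
    have hlow : ∀ j < k, t i ∉ layer I t c v j := fun j hj hm =>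
      hmin (j + 1) (by omega) (mem_layer_succ_of_move hiI hm)
    obtain ⟨h, hadm, hmoved, hload⟩ := ih hik hlow
    -- Moved voters have their sincere candidate in a layer before `k`, while `t i` first appears in
    -- layer `k`; so this voter is still at the sincere option.
    have hit : h i = t i := by
      by_contra hne
      obtain ⟨j, hj, hm⟩ := hmoved i hiI hne
      exact hlow j hj hm
    refine ⟨Function.update h i (c i), hadm.update (Or.inr rfl), ?_, fun z => ?_⟩
    · intro l hl hne
      by_cases e : l = i
      · subst e
        exact ⟨k, Nat.lt_succ_self k, hik⟩
      · rw [Function.update_of_ne e] at hne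
        obtain ⟨j, hj, hm⟩ := hmoved l hl hne
        exact ⟨j, by omega, hm⟩
    · have h1 := load_update h hiI (c i) z
      have h2 := hload z
      rw [hit] at h1
      omega

theorem exists_reallocation {k : ℕ} {s : C} (hs : s ∈ layer I t c v k) :
    ∃ h, Admissible I t c h ∧
      ∀ z, load I h z + (if v = z then 1 else 0) = load I t z + (if s = z then 1 else 0) := by
  classical
  have hex : ∃ k, s ∈ layer I t c v k := ⟨k, hs⟩
  obtain ⟨h, h1, -, h2⟩ := exists_reallocation_of_mem_layer (Nat.find_spec hex)
    fun j hj => Nat.find_min hex hj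
  exact ⟨h, h1, h2⟩

/-- The number of voters who have the option `x`. -/
def optionCount (I : Finset ι) (t c : ι → C) (x : C) : ℕ :=
  (I.filter fun i => t i = x ∨ c i = x).card

/-- The number of voters who have the option `x` or the option `y`. -/
def optionCount₂ (I : Finset ι) (t c : ι → C) (x y : C) : ℕ :=
  (I.filter fun i => (t i = x ∨ c i = x) ∨ (t i = y ∨ c i = y)).card

theorem Admissible.load_le {h : ι → C} (hh : Admissible I t c h) (x : C) :
    load I h x ≤ optionCount I t c x := by
  refine card_le_card fun i hi => ?_
  obtain ⟨hi, e⟩ := mem_filter.1 hi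
  refine mem_filter.2 ⟨hi, ?_⟩
  rcases hh i hi with h' | h'
  · exact Or.inl (h' ▸ e)
  · exact Or.inr (h' ▸ e)

theorem Admissible.load_add_load_le {h : ι → C} (hh : Admissible I t c h) {x y : C} (hxy : x ≠ y) :
    load I h x + load I h y ≤ optionCount₂ I t c x y := by
  rw [load, load, ← card_union_of_disjoint]
  · refine card_le_card fun i hi => ?_
    simp only [mem_union, mem_filter] at hi ⊢
    have hiI : i ∈ I := hi.elim And.left And.left
    refine ⟨hiI, ?_⟩
    rcases hh i hiI with h' | h' <;> rw [← h'] <;> tauto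
  · exact disjoint_filter.2 fun i _ h1 h2 => hxy (h1.symm.trans h2)

/-- Raises the load of `x` by one, keeping that of `y` and increasing no third load; the bounds `ok`
survive because they are closed downwards. -/
theorem exists_load_succ {ok : C → ℕ → Prop} (hok : ∀ z j k, j ≤ k → ok z k → ok z j)
    {x y : C} (hxy : x ≠ y) {X Y : ℕ} (hX : ok x X) {h : ι → C} (hh : Admissible I t c h)
    (hhok : ∀ z, ok z (load I h z)) (hx : load I h x < X) (hy : load I h y ≤ Y)
    (cx : X ≤ optionCount I t c x)
    (cxy : X + Y ≤ optionCount₂ I t c x y) :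
    ∃ h', Admissible I t c h' ∧ (∀ z, ok z (load I h' z)) ∧ load I h' x = load I h x + 1 ∧
      load I h' y = load I h y := by
  by_cases hA : ∃ j ∈ I, (t j = x ∨ c j = x) ∧ h j ≠ x ∧ h j ≠ y
  · obtain ⟨j, hj, hjo, hjx, hjy⟩ := hA
    have L := load_update h hj x
    have Lx := L x
    have Ly := L y
    simp only [hjx, hjy, hxy, if_true, if_false] at Lx Ly
    refine ⟨_, hh.update hjo, fun z => ?_, by omega, by omega⟩
    by_cases hz : z = x
    · subst hz
      exact hok _ _ X (by omega) hX
    · have Lz := L z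
      rw [if_neg (Ne.symm hz)] at Lz
      exact hok _ _ _ (by omega) (hhok z)
  -- Now every voter with option `x` sits at `x` or `y`. One of them moves from `y` to `x`, and the
  -- count `cxy` supplies a replacement at `y` from a third candidate.
  · push Not at hA
    obtain ⟨i, hi, hio, hix⟩ : ∃ i ∈ I, (t i = x ∨ c i = x) ∧ h i ≠ x := by
      by_contra! hB
      have : optionCount I t c x ≤ load I h x := card_le_card fun i hi => by
        obtain ⟨hi, e⟩ := mem_filter.1 hi
        exact mem_filter.2 ⟨hi, hB i hi e⟩
      omega
    have hiy := hA i hi hio hix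
    obtain ⟨j, hj, hjo, hjx, hjy⟩ : ∃ j ∈ I, (t j = y ∨ c j = y) ∧ h j ≠ x ∧ h j ≠ y := by
      by_contra! hB
      have : optionCount₂ I t c x y ≤ load I h x + load I h y := by
        rw [load, load, ← card_union_of_disjoint
          (disjoint_filter.2 fun i _ h1 h2 => hxy (h1.symm.trans h2))]
        refine card_le_card fun l hl => ?_
        obtain ⟨hl, e⟩ := mem_filter.1 hl
        simp only [mem_union, mem_filter, hl, true_and]
        by_cases hlx : h l = x
        · exact Or.inl hlx
        · exact Or.inr (e.elim (fun e => hA l hl e hlx) (fun e => hB l hl e hlx))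
      omega
    have hji : j ≠ i := fun e => hjy (e ▸ hiy)
    have L := load_update h hi x
    have L' := load_update (Function.update h i x) hj y
    simp only [Function.update_of_ne hji] at L'
    have Lx := L x
    have Ly := L y
    have Lx' := L' x
    have Ly' := L' y
    simp only [hjx, hjy, hxy, hxy.symm, hiy, if_true, if_false] at Lx Ly Lx' Ly'
    refine ⟨_, (hh.update hio).update hjo, fun z => ?_, by omega, by omega⟩
    by_cases hz : z = x
    · subst hz
      exact hok _ _ X (by omega) hX
    · by_cases hz' : z = y
      · subst hz'
        exact hok _ _ _ (by omega) (hhok z)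
      · have Lz := L z
        have Lz' := L' z
        rw [if_neg (Ne.symm hz)] at Lz
        rw [if_neg (Ne.symm hz')] at Lz'
        exact hok _ _ _ (by omega) (hhok z)

theorem optionCount₂_comm (x y : C) : optionCount₂ I t c x y = optionCount₂ I t c y x := by
  simp only [optionCount₂, or_comm]

/-- Induction on the total deficit `d`; the hypotheses `cx`, `cy`, `cxy` are Hall's conditions for
the two targets. -/
theorem exists_load_eq {ok : C → ℕ → Prop} (hok : ∀ z j k, j ≤ k → ok z k → ok z j)
    {x y : C} (hxy : x ≠ y) {X Y : ℕ} (hX : ok x X) (hY : ok y Y)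
    (cx : X ≤ optionCount I t c x) (cy : Y ≤ optionCount I t c y)
    (cxy : X + Y ≤ optionCount₂ I t c x y) (d : ℕ) :
    ∀ h : ι → C, Admissible I t c h → (∀ z, ok z (load I h z)) → load I h x ≤ X →
      load I h y ≤ Y → X + Y = load I h x + load I h y + d →
    ∃ h', Admissible I t c h' ∧ (∀ z, ok z (load I h' z)) ∧ load I h' x = X ∧
      load I h' y = Y := by
  induction d with
  | zero => exact fun h hh hhok hx hy e => ⟨h, hh, hhok, by omega, by omega⟩
  | succ d ih =>
    intro h hh hhok hx hy e
    rcases hx.lt_or_eq with hlt | heq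
    · obtain ⟨h', h1, h2, h3, h4⟩ := exists_load_succ hok hxy hX hh hhok hlt hy cx cxy
      exact ih h' h1 h2 (by omega) (by omega) (by omega)
    · obtain ⟨h', h1, h2, h3, h4⟩ := exists_load_succ hok hxy.symm hY hh hhok
        (show load I h y < Y by omega) hx cy (by rw [optionCount₂_comm]; omega)
      exact ih h' h1 h2 (by omega) (by omega) (by omega)

/-- If no load increases on a set that is closed under moves, then the loads on this set do not
change. -/
theorem load_eq_of_closed {h : ι → C} (hh : Admissible I t c h) (U : Finset C)
    (hU : ∀ i ∈ I, t i ∈ U → c i ∈ U) (hle : ∀ s ∈ U, load I h s ≤ load I t s) :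
    ∀ s ∈ U, load I h s = load I t s := by
  -- A voter whose sincere candidate lies in `U` cannot leave `U`, so the total load on `U` does not
  -- drop.
  refine (sum_eq_sum_iff_of_le hle).1 (le_antisymm (sum_le_sum hle) ?_)
  rw [sum_load_subset, sum_load_subset]
  refine card_le_card fun i hi => ?_
  obtain ⟨hi, e⟩ := mem_filter.1 hi
  refine mem_filter.2 ⟨hi, ?_⟩
  rcases hh i hi with h' | h' <;> rw [h']
  · exact e
  · exact hU i hi e

end Reallocation

/-! ### Elections with one undecided ballot -/

section Outcomes

/-- A candidate with score `k` and position `p` in the tie-breaking order beats one with score `k'`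
and position `p'`. -/
def Beats (k p k' p' : ℕ) : Prop := k' < k ∨ k' = k ∧ p < p'

instance (k p k' p' : ℕ) : Decidable (Beats k p k' p') := by unfold Beats; infer_instance

variable {ι C : Type*} [DecidableEq ι] [DecidableEq C]

/-- `x` wins if the scores are `f` and one more vote goes to `a`. -/
def Wins (pos : C → ℕ) (a : C) (f : C → ℕ) (x : C) : Prop :=
  ∀ z, z ≠ x → Beats (f x + if a = x then 1 else 0) (pos x) (f z + if a = z then 1 else 0) (pos z)

/-- Score `k` of `z` is compatible with scores at most `X` of `x` and at most `Y` of `y`, where `x`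
with score `X` wins after a vote for `a` and `y` with score `Y` wins after a vote for `b`. -/
def Compatible (pos : C → ℕ) (a b x y : C) (X Y : ℕ) (z : C) (k : ℕ) : Prop :=
  (z = x → k ≤ X) ∧ (z = y → k ≤ Y) ∧
  (z ≠ x → Beats (X + if a = x then 1 else 0) (pos x) (k + if a = z then 1 else 0) (pos z)) ∧
  (z ≠ y → Beats (Y + if b = y then 1 else 0) (pos y) (k + if b = z then 1 else 0) (pos z))

instance (pos : C → ℕ) (a b x y : C) (X Y : ℕ) (z : C) (k : ℕ) :
    Decidable (Compatible pos a b x y X Y z k) := by unfold Compatible; infer_instance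

theorem Compatible.mono {pos : C → ℕ} {a b x y : C} {X Y : ℕ} (z : C) (j k : ℕ) (hjk : j ≤ k)
    (h : Compatible pos a b x y X Y z k) : Compatible pos a b x y X Y z j := by
  obtain ⟨h1, h2, h3, h4⟩ := h
  unfold Beats at h3 h4
  refine ⟨fun e => hjk.trans (h1 e), fun e => hjk.trans (h2 e), fun e => ?_, fun e => ?_⟩
  · have := h3 e; unfold Beats; omega
  · have := h4 e; unfold Beats; omega

/-- With `X` and `Y` equal to the actual loads the two caps are trivial and only the winning
conditions remain. -/
theorem compatible_load_iff {pos : C → ℕ} {a b x y : C} {f : C → ℕ} :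
    (∀ z, Compatible pos a b x y (f x) (f y) z (f z)) ↔ Wins pos a f x ∧ Wins pos b f y := by
  refine ⟨fun h => ⟨fun z => (h z).2.2.1, fun z => (h z).2.2.2⟩, fun h z => ⟨?_, ?_, h.1 z, h.2 z⟩⟩
  · rintro rfl; exact le_rfl
  · rintro rfl; exact le_rfl

variable (I : Finset ι) (t c : ι → C) (pos : C → ℕ)

/-- The sincere votes `t`, together with the sincere vote `t₀`, elect `w`, and every voter of `I`
with a second option can make it win. -/
structure SincereState (t₀ w : C) : Prop where
  wins : Wins pos t₀ (load I t) w
  ne_winner : ∀ i ∈ I, c i ≠ t i → t i ≠ w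
  option_ne_winner : ∀ i ∈ I, c i ≠ t i → c i ≠ w
  option_beats : ∀ i ∈ I, c i ≠ t i →
    Beats (load I t (c i) + (if t₀ = c i then 1 else 0) + 1) (pos (c i))
      (load I t w + if t₀ = w then 1 else 0) (pos w)

variable {I t c pos} {t₀ w a b x y : C} {h : ι → C}

/-- A voter with two different options has `w` as neither of them. -/
theorem SincereState.load_winner (H : SincereState I t c pos t₀ w) (hh : Admissible I t c h) :
    load I h w = load I t w := by
  unfold load
  congr 1
  refine filter_congr fun i hi => ?_
  by_cases e : c i = t i
  · rcases hh i hi with h' | h' <;> simp [h', e]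
  · have h1 := H.ne_winner i hi e
    have h2 := H.option_ne_winner i hi e
    rcases hh i hi with h' | h' <;> simp [h', h1, h2]

/-- If `t₀ ≠ w`, the level of `w` contains no ballot of the distinguished voter and cannot fall
below its sincere value. If `t₀ = w`, that ballot may go elsewhere, but some candidate has gained a
vote and so beats the sincere level of `w`; the winner is this candidate or beats it. -/
theorem SincereState.winner_level [Fintype C] (H : SincereState I t c pos t₀ w)
    (hh : Admissible I t c h) (hne : load I h ≠ load I t) (hx : Wins pos a (load I h) x)
    (hxw : x ≠ w) :
    Beats (load I h x + if a = x then 1 else 0) (pos x)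
      (load I t w + if t₀ = w then 1 else 0) (pos w) := by
  by_cases hw : t₀ = w
  · obtain ⟨z, hz⟩ := exists_load_lt hne
    obtain ⟨i, hi, hc, hct⟩ := hh.exists_move hz
    have h1 := H.option_ne_winner i hi hct
    have h2 := H.option_beats i hi hct
    rw [hc] at h1 h2
    rw [if_neg (by rw [hw]; exact h1.symm)] at h2
    by_cases e : z = x
    · subst e
      unfold Beats at *
      omega
    · have h3 := hx z e
      unfold Beats at *
      omega
  · have h1 := hx w hxw.symm
    rw [H.load_winner hh] at h1
    rw [if_neg hw]
    unfold Beats at *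
    omega

/-- The level of `x` is compared with `z` through the sincere level of `w`, which beats or equals
that of `z`. For `x = w` with `t₀ = w`, a candidate that has gained a vote again replaces the ballot
that may be lost. -/
theorem SincereState.compatible_of_ne [Fintype C] (H : SincereState I t c pos t₀ w)
    (hpos : Function.Injective pos) (hh : Admissible I t c h)
    (hne : load I h ≠ load I t) (hx : Wins pos a (load I h) x)
    {z : C} {k : ℕ} (hk : k + (if a = z then 1 else 0) ≤ load I t z) (hz : z ≠ x) :
    Beats (load I h x + if a = x then 1 else 0) (pos x) (k + if a = z then 1 else 0) (pos z) := by
  have hp : pos z ≠ pos x := fun e => hz (hpos e)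
  by_cases hxw : x = w
  · subst hxw
    have h1 := hx
    have h2 := H.wins z hz
    by_cases hw : t₀ = x
    · have e := H.load_winner hh
      obtain ⟨u, hu⟩ := exists_load_lt hne
      have hux : u ≠ x := by rintro rfl; omega
      have h3 := hx u hux
      obtain ⟨i, hi, hc, hct⟩ := hh.exists_move hu
      have h4 := H.option_beats i hi hct
      rw [hc] at h4
      rw [if_neg (by rw [hw]; exact hux.symm)] at h4
      unfold Beats at *
      omega
    · have e := H.load_winner hh
      rw [if_neg hw] at h2
      unfold Beats at *
      omega
  · have h1 := H.winner_level hh hne hx hxw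
    by_cases hzw : z = w
    · subst hzw
      unfold Beats at *
      omega
    · have h2 := H.wins z hzw
      unfold Beats at *
      omega

/-- For `x ≠ w` the new level of `x` beats the sincere level of `w`, which beats that of `x`. The
total of `x` therefore exceeds its sincere load, and the ballot for `a` accounts for at most one
vote. -/
theorem SincereState.load_le_of_wins [Fintype C] (H : SincereState I t c pos t₀ w)
    (hh : Admissible I t c h) (hne : load I h ≠ load I t) (hx : Wins pos a (load I h) x) :
    load I t x ≤ load I h x := by
  by_cases hxw : x = w
  · subst hxw
    exact (H.load_winner hh).ge
  · have h1 := H.winner_level hh hne hx hxw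
    have h2 := H.wins x hxw
    unfold Beats at *
    split_ifs at * <;> omega

/-- If neither ballot supports its own winner, then `x` and `y` would beat each other under the
common scores `f`. -/
theorem eq_or_eq_of_wins {f : C → ℕ} (hxy : x ≠ y) (hx : Wins pos a f x) (hy : Wins pos b f y) :
    a = x ∨ b = y := by
  by_contra! hB
  have h1 := hx y hxy.symm
  have h2 := hy x hxy
  rw [if_neg hB.1] at h1
  rw [if_neg hB.2] at h2
  unfold Beats at *
  omega

/-- The violated bounds, with multiplicity two if the excess is at least two. -/
def violations [Fintype C] (I : Finset ι) (t : ι → C) (ok : C → ℕ → Prop)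
    [∀ z k, Decidable (ok z k)] : ℕ :=
  ∑ z, ((if ok z (load I t z) then 0 else 1) + (if ok z (load I t z - 1) then 0 else 1))

/-- The criterion for the existence of options that make `x` win after a vote for `a`, with score
`X` without this vote, and `y` win after a vote for `b`, with score `Y` without this vote. -/
def Criterion [Fintype C] (I : Finset ι) (t c : ι → C) (pos : C → ℕ) (a b x y : C) (X Y : ℕ) :
    Prop :=
  Compatible pos a b x y X Y x X ∧ Compatible pos a b x y X Y y Y ∧
  X ≤ optionCount I t c x ∧ Y ≤ optionCount I t c y ∧ X + Y ≤ optionCount₂ I t c x y ∧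
  (violations I t (Compatible pos a b x y X Y) = 0 ∨
    violations I t (Compatible pos a b x y X Y) = 1 ∧
    ∃ s, Compatible pos a b x y X Y s (load I t s + 1) ∧
      (¬ Compatible pos a b x y X Y a (load I t a) ∧ s ∈ layer I t c a (Fintype.card C) ∨
       ¬ Compatible pos a b x y X Y b (load I t b) ∧ s ∈ layer I t c b (Fintype.card C)))

/-- The value one of `violations` means that `v` is the only overfull candidate and that removing
one vote repairs it; a path to a candidate with slack does so. -/
theorem exists_admissible_of_violation [Fintype C] {ok : C → ℕ → Prop} [∀ z k, Decidable (ok z k)]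
    (hok : ∀ z j k, j ≤ k → ok z k → ok z j) (hv : violations I t ok = 1) {v s : C}
    (hs : ok s (load I t s + 1)) (hnv : ¬ ok v (load I t v)) {k : ℕ}
    (hl : s ∈ layer I t c v k) :
    ∃ h, Admissible I t c h ∧ ∀ z, ok z (load I h z) := by
  obtain ⟨h, h1, h2⟩ := exists_reallocation hl
  refine ⟨h, h1, fun z => ?_⟩
  have hsv : s ≠ v := by
    rintro rfl
    exact hnv (hok _ _ _ (Nat.le_succ _) hs)
  have hz := h2 z
  rw [violations, ← add_sum_erase _ _ (mem_univ v)] at hv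
  rw [if_neg hnv] at hv
  by_cases e : z = v
  · subst e
    rw [if_pos rfl, if_neg hsv] at hz
    have hz1 : ok z (load I t z - 1) := by
      by_contra hn
      rw [if_neg hn] at hv
      omega
    exact hok _ _ _ (by omega) hz1
  · rw [if_neg (Ne.symm e)] at hz
    by_cases e' : s = z
    · subst e'
      rw [if_pos rfl] at hz
      exact hok _ _ _ (by omega) hs
    · rw [if_neg e'] at hz
      have h0 : ∑ z ∈ univ.erase v, ((if ok z (load I t z) then 0 else 1) +
          (if ok z (load I t z - 1) then 0 else 1)) = 0 := by omega
      have := (sum_eq_zero_iff.1 h0) z (mem_erase.2 ⟨e, mem_univ z⟩)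
      have : ok z (load I t z) := by
        by_contra hn
        rw [if_neg hn] at this
        omega
      exact hok _ _ _ (by omega) this

/-- Repair the bounds first, then fill up `x` and `y`; the second phase cannot destroy the first. -/
theorem Criterion.exists_admissible [Fintype C] (hxy : x ≠ y) {X Y : ℕ}
    (H : Criterion I t c pos a b x y X Y) :
    ∃ h, Admissible I t c h ∧ Wins pos a (load I h) x ∧ Wins pos b (load I h) y := by
  obtain ⟨hX, hY, cx, cy, cxy, hv⟩ := H
  obtain ⟨h, h1, h2⟩ : ∃ h, Admissible I t c h ∧
      ∀ z, Compatible pos a b x y X Y z (load I h z) := by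
    rcases hv with hv | ⟨hv, s, hs, ⟨hn, hl⟩ | ⟨hn, hl⟩⟩
    · refine ⟨t, fun _ _ => Or.inl rfl, fun z => ?_⟩
      have := (sum_eq_zero_iff.1 hv) z (mem_univ z)
      by_contra hn
      rw [if_neg hn] at this
      omega
    · exact exists_admissible_of_violation Compatible.mono hv hs hn hl
    · exact exists_admissible_of_violation Compatible.mono hv hs hn hl
  have hx := (h2 x).1 rfl
  have hy := (h2 y).2.1 rfl
  obtain ⟨h', h1', h2', rfl, rfl⟩ := exists_load_eq Compatible.mono hxy hX hY cx cy cxy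
    (X + Y - load I h x - load I h y) h h1 h2 hx hy (by omega)
  exact ⟨h', h1', compatible_load_iff.1 h2'⟩

/-- Otherwise the set reachable from `v` is closed under moves and has no slack, so `v` keeps its
forbidden load under every assignment that respects the bounds. -/
theorem exists_slack [Fintype C] {ok : C → ℕ → Prop}
    (hok : ∀ z j k, j ≤ k → ok z k → ok z j) (hh : Admissible I t c h)
    (hhok : ∀ z, ok z (load I h z)) {v : C} (hnv : ¬ ok v (load I t v)) :
    ∃ s, ok s (load I t s + 1) ∧ s ∈ layer I t c v (Fintype.card C) := by
  by_contra! hB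
  refine hnv ?_
  have := load_eq_of_closed hh (layer I t c v (Fintype.card C))
    (fun i hi hm => mem_layer_card (mem_layer_succ_of_move hi hm))
    (fun s hs => by
      by_contra hlt
      exact hB s (hok _ _ _ (by omega) (hhok s)) hs) v
    (layer_mono (Nat.zero_le _) (by simp [layer]))
  rw [← this]
  exact hhok v

/-- The necessity of the criterion: after a genuine change of the loads, the sincere loads exceed
the bounds in at most one place and by at most one vote. -/
theorem SincereState.criterion [Fintype C] (H : SincereState I t c pos t₀ w)
    (hpos : Function.Injective pos) (hh : Admissible I t c h) (hxy : x ≠ y)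
    (hx : Wins pos a (load I h) x) (hy : Wins pos b (load I h) y) :
    Criterion I t c pos a b x y (load I h x) (load I h y) := by
  have hok := compatible_load_iff.2 ⟨hx, hy⟩
  refine ⟨hok x, hok y, hh.load_le x, hh.load_le y, hh.load_add_load_le hxy, ?_⟩
  by_cases hne : load I h = load I t
  · left
    rw [violations]
    refine sum_eq_zero fun z _ => ?_
    have h1 := hok z
    rw [hne] at h1 ⊢
    rw [if_pos h1, if_pos (h1.mono _ _ _ (Nat.sub_le _ _)), add_zero]
  set ok := Compatible pos a b x y (load I h x) (load I h y) with hokdef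
  -- A bound can fail only at a candidate that receives the extra ballot without being the winner
  -- after this ballot.
  have hviol : ∀ z, ¬ ok z (load I t z) → a = z ∧ a ≠ x ∨ b = z ∧ b ≠ y := by
    intro z hn
    by_contra! hB
    refine hn ⟨?_, ?_, fun hz => ?_, fun hz => ?_⟩
    · rintro rfl
      exact H.load_le_of_wins hh hne hx
    · rintro rfl
      exact H.load_le_of_wins hh hne hy
    · by_cases e : a = z
      · exact absurd (hB.1 e) (by rw [e]; exact hz)
      · exact H.compatible_of_ne hpos hh hne hx (by rw [if_neg e]; omega) hz
    · by_cases e : b = z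
      · exact absurd (hB.2 e) (by rw [e]; exact hz)
      · exact H.compatible_of_ne hpos hh hne hy (by rw [if_neg e]; omega) hz
  -- One vote fewer absorbs the extra ballot, so the second summand of `violations` vanishes. A load
  -- of zero needs its own case because of truncated subtraction.
  have hpred : ∀ z, ok z (load I t z - 1) := by
    intro z
    rcases Nat.eq_zero_or_pos (load I t z) with h0 | h0
    · exact Compatible.mono _ _ _ (by omega) (hok z)
    · refine ⟨?_, ?_, fun hz => ?_, fun hz => ?_⟩
      · rintro rfl
        have := H.load_le_of_wins hh hne hx
        omega
      · rintro rfl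
        have := H.load_le_of_wins hh hne hy
        omega
      · exact H.compatible_of_ne hpos hh hne hx (by split_ifs <;> omega) hz
      · exact H.compatible_of_ne hpos hh hne hy (by split_ifs <;> omega) hz
  have hsum : violations I t ok = ∑ z, if ok z (load I t z) then 0 else 1 :=
    sum_congr rfl fun z _ => by rw [if_pos (hpred z), add_zero]
  by_cases hall : ∀ z, ok z (load I t z)
  · left
    rw [hsum]
    exact sum_eq_zero fun z _ => if_pos (hall z)
  · right
    push Not at hall
    obtain ⟨v, hv⟩ := hall
    have hex := eq_or_eq_of_wins hxy hx hy
    refine ⟨?_, ?_⟩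
    -- Two different violated candidates would be `a ≠ x` and `b ≠ y`, contrary to `hex`.
    · rw [hsum, sum_eq_single v, if_neg hv]
      · intro z _ hzv
        by_contra hn
        have hz := hviol z (fun hz => hn (if_pos hz))
        have hv := hviol v hv
        rcases hz with ⟨rfl, h1⟩ | ⟨rfl, h1⟩ <;> rcases hv with ⟨rfl, h2⟩ | ⟨rfl, h2⟩ <;> tauto
      · exact fun hn => absurd (mem_univ v) hn
    · obtain ⟨s, hs, hl⟩ := exists_slack Compatible.mono hh hok hv
      refine ⟨s, hs, ?_⟩
      rcases hviol v hv with ⟨rfl, -⟩ | ⟨rfl, -⟩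
      · exact Or.inl ⟨hv, hl⟩
      · exact Or.inr ⟨hv, hl⟩

end Outcomes

/-! ### Plurality in terms of loads. -/

section Plurality

variable {n m : ℕ} [NeZero n] [NeZero m]

/-- The position of a candidate in a vote. -/
def rank (v : Vote m) (z : Fin m) : ℕ := (v.symm z : ℕ)

theorem rank_injective (v : Vote m) : Function.Injective (rank v) :=
  Fin.val_injective.comp v.symm.injective

theorem prefers_iff (v : Vote m) (x y : Fin m) : Prefers v x y ↔ rank v x < rank v y := Iff.rfl

/-- All voters except the distinguished one. -/
def others (n : ℕ) [NeZero n] : Finset (Fin n) := univ.erase 0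

theorem mem_others {i : Fin n} : i ∈ others n ↔ i ≠ 0 := by simp [others]

theorem score_one (V : Profile n m) (z : Fin m) :
    score 1 V z = load (others n) (fun i => V i 0) z + if V 0 0 = z then 1 else 0 := by
  have key : ∀ i, ((V i).symm z : ℕ) < 1 ↔ V i 0 = z := by
    intro i
    rw [Nat.lt_one_iff, ← Fin.val_zero m, Fin.val_inj, Equiv.symm_apply_eq, eq_comm]
  simp only [score, key]
  rw [load, card_filter, card_filter, others, sum_erase_add _ _ (mem_univ _)]

theorem plurality_eq_iff (tb : Vote m) (V : Profile n m) (x : Fin m) :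
    plurality tb V = x ↔
      ∀ z, z ≠ x → Beats (score 1 V x) (rank tb x) (score 1 V z) (rank tb z) := by
  have hwin : ∀ x, plurality tb V = x →
      ∀ z, z ≠ x → Beats (score 1 V x) (rank tb x) (score 1 V z) (rank tb z) := by
    rintro x rfl z hz
    have hmem := min'_mem _ (topPositions_nonempty 1 tb V)
    have hmin : ∀ p ∈ topPositions 1 tb V,
        (topPositions 1 tb V).min' (topPositions_nonempty 1 tb V) ≤ p :=
      fun p hp => min'_le _ p hp
    set p := (topPositions 1 tb V).min' (topPositions_nonempty 1 tb V) with hp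
    have hw : plurality tb V = tb p := rfl
    rw [hw] at hz ⊢
    have hle : ∀ d, score 1 V d ≤ score 1 V (tb p) := by simpa [topPositions] using hmem
    rcases (hle z).lt_or_eq with h | h
    · exact Or.inl h
    · refine Or.inr ⟨h, ?_⟩
      have hz' : tb.symm z ∈ topPositions 1 tb V := by
        simp only [topPositions, mem_filter, mem_univ, true_and, Equiv.apply_symm_apply, h]
        exact hle
      have h1 := hmin _ hz'
      have h2 : p ≠ tb.symm z := fun e => hz (by rw [e, Equiv.apply_symm_apply])
      rw [rank, rank, Equiv.symm_apply_apply]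
      exact lt_of_le_of_ne h1 fun e => h2 (Fin.ext e)
  refine ⟨hwin x, fun h => ?_⟩
  -- Two different candidates cannot beat each other.
  by_contra hne
  have h1 := h _ hne
  have h2 := hwin _ rfl x (Ne.symm hne)
  unfold Beats at *
  omega

theorem plurality_eq_iff_wins (tb : Vote m) (V : Profile n m) (x : Fin m) :
    plurality tb V = x ↔ Wins (rank tb) (V 0 0) (load (others n) fun i => V i 0) x := by
  rw [plurality_eq_iff]
  simp only [score_one, Wins]

/-- The last top candidate in a list of votes that differs from `t`, if any. -/
def lastOtherTop (t : Fin m) (L : List (Vote m)) : Fin m :=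
  L.foldl (fun acc v => if v 0 ≠ t then v 0 else acc) t

/-- The update that the machine performs when it reads one more strategy. -/
theorem lastOtherTop_concat (t : Fin m) (L : List (Vote m)) (v : Vote m) :
    lastOtherTop t (L ++ [v]) = if v 0 ≠ t then v 0 else lastOtherTop t L := by
  simp [lastOtherTop, List.foldl_append]

theorem lastOtherTop_spec (t : Fin m) (L : List (Vote m)) :
    (lastOtherTop t L = t ∧ ∀ v ∈ L, v 0 = t) ∨
      (lastOtherTop t L ≠ t ∧ ∃ v ∈ L, v 0 = lastOtherTop t L) := by
  induction L using List.reverseRecOn with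
  | nil => left; simp [lastOtherTop]
  | append_singleton L v ih =>
    rw [lastOtherTop_concat]
    by_cases hv : v 0 = t
    · rw [if_neg (not_not.2 hv)]
      rcases ih with ⟨h1, h2⟩ | ⟨h1, w, hw, h2⟩
      · left
        refine ⟨h1, fun w hw => ?_⟩
        rcases List.mem_append.1 hw with hw | hw
        · exact h2 w hw
        · rw [List.mem_singleton.1 hw, hv]
      · exact Or.inr ⟨h1, w, List.mem_append_left _ hw, h2⟩
    · rw [if_pos hv]
      exact Or.inr ⟨hv, v, by simp, rfl⟩

/-! ### Level-1 strategies of manipulators. -/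

section LevelOne

variable {tb : Vote m} {V : Profile n m} {i : Fin n}

/-- A voter whose favourite is elected cannot improve the outcome. -/
theorem IsGSManipulator.top_ne_winner (hi : IsGSManipulator (plurality tb) V i) :
    V i 0 ≠ plurality tb V := by
  intro e
  obtain ⟨v', hv'⟩ := hi
  have h : (V i).symm (plurality tb (Function.update V i v')) < (V i).symm (plurality tb V) := hv'
  rw [← e, Equiv.symm_apply_apply] at h
  exact absurd h (not_lt.2 (Fin.zero_le _))

/-- The level-1 outcome is at least as good as that of a successful manipulation, hence better than
the sincere one. -/
theorem IsGSManipulator.winner_ne (hi : IsGSManipulator (plurality tb) V i) {v' : Vote m}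
    (hv : IsLevelOne (plurality tb) V i v') :
    plurality tb (Function.update V i v') ≠ plurality tb V := by
  intro e
  obtain ⟨z, hz⟩ := hi
  have h1 : rank (V i) _ < rank (V i) _ := hz
  have hne : plurality tb (Function.update V i z) ≠ plurality tb (Function.update V i v') := by
    intro e'
    rw [e', e] at h1
    exact lt_irrefl _ h1
  have h2 : rank (V i) _ < rank (V i) _ := hv _ ⟨z, rfl⟩ hne
  rw [e] at h2
  omega

theorem IsLevelOne.winner_unique {v v' : Vote m} (hv : IsLevelOne (plurality tb) V i v)
    (hv' : IsLevelOne (plurality tb) V i v') :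
    plurality tb (Function.update V i v) = plurality tb (Function.update V i v') := by
  by_contra hne
  have h1 : rank (V i) _ < rank (V i) _ := hv _ ⟨v', rfl⟩ (Ne.symm hne)
  have h2 : rank (V i) _ < rank (V i) _ := hv' _ ⟨v, rfl⟩ hne
  omega

theorem score_update (V : Profile n m) (i : Fin n) (v' : Vote m) (z : Fin m) :
    score 1 (Function.update V i v') z + (if V i 0 = z then 1 else 0)
      = score 1 V z + if v' 0 = z then 1 else 0 := by
  have key : ∀ V : Profile n m, score 1 V z = load univ (fun j => V j 0) z := by
    intro V
    rw [score_one, load, load, card_filter, card_filter, others, sum_erase_add _ _ (mem_univ _)]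
  have hfun : (fun j => Function.update V i v' j 0)
      = Function.update (fun j => V j 0) i (v' 0) := by
    ext j
    by_cases e : j = i
    · subst e; simp
    · simp [e]
  rw [key, key, hfun]
  exact load_update _ (mem_univ i) _ z

/-- The sincere winner loses no vote, since the manipulator does not have it on top. A new winner
must therefore be the candidate that gains the vote, and this one vote must be enough. -/
theorem IsGSManipulator.level_one (hi : IsGSManipulator (plurality tb) V i) {v' : Vote m}
    (hv : IsLevelOne (plurality tb) V i v') :
    plurality tb (Function.update V i v') = v' 0 ∧ v' 0 ≠ plurality tb V ∧
      Beats (score 1 V (v' 0) + 1) (rank tb (v' 0)) (score 1 V (plurality tb V))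
        (rank tb (plurality tb V)) := by
  have hne := hi.winner_ne hv
  have htop := hi.top_ne_winner
  have h1 := (plurality_eq_iff tb V _).1 rfl
  have h2 := (plurality_eq_iff tb (Function.update V i v') _).1 rfl
  set w := plurality tb V
  set r := plurality tb (Function.update V i v')
  have h1r := h1 r hne
  have h2w := h2 w hne.symm
  have e1 := score_update V i v' r
  have e2 := score_update V i v' w
  have hr : v' 0 = r := by
    by_contra hn
    rw [if_neg hn] at e1
    rw [if_neg htop] at e2
    unfold Beats at *
    omega
  rw [hr]
  refine ⟨rfl, hne, ?_⟩
  rw [if_pos hr] at e1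
  rw [if_neg htop] at e2
  unfold Beats at *
  omega

end LevelOne

/-! ### Weak dominance as a question about two-option voters. -/

section Dominance

variable {tb : Vote m} (G : GSGame (n := n) (plurality tb)) (listing : Fin n → List (Vote m))

/-- The sincere top candidates. -/
def sincereTop (i : Fin n) : Fin m := G.profile i 0

/-- The top candidate of the insincere strategies of a voter, if there are any. -/
def insincereTop (i : Fin n) : Fin m := lastOtherTop (G.profile i 0) (listing i)

variable {G listing}

theorem insincereTop_spec
    (hplayer : ∀ i, (listing i.1).toFinset = G.strat i)
    (hnon : ∀ i : Fin n, ¬ (i ≠ 0 ∧ IsGSManipulator (plurality tb) G.profile i) → listing i = [])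
    {i : Fin n} (hne : insincereTop G listing i ≠ sincereTop G i) :
    ∃ h : i ≠ 0 ∧ IsGSManipulator (plurality tb) G.profile i, ∃ v' ∈ G.strat ⟨i, h⟩,
      v' 0 = insincereTop G listing i ∧ IsLevelOne (plurality tb) G.profile i v' := by
  rcases lastOtherTop_spec (G.profile i 0) (listing i) with h | ⟨-, v', hv', e⟩
  · exact absurd h.1 hne
  · have hi : i ≠ 0 ∧ IsGSManipulator (plurality tb) G.profile i := by
      by_contra hi
      rw [hnon i hi] at hv'
      simp at hv'
    have hmem : v' ∈ G.strat ⟨i, hi⟩ := by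
      rw [← hplayer]
      simpa using hv'
    refine ⟨hi, v', hmem, e, G.level_one ⟨i, hi⟩ v' hmem ?_⟩
    rintro rfl
    exact hne e.symm

/-- Level-1 strategies have a common winner, which is their top, so it does not matter which
insincere strategy `lastOtherTop` picks. -/
theorem top_of_mem_strat
    (hplayer : ∀ i, (listing i.1).toFinset = G.strat i)
    {i : Fin n} (hi : i ≠ 0 ∧ IsGSManipulator (plurality tb) G.profile i)
    {v' : Vote m} (hv' : v' ∈ G.strat ⟨i, hi⟩) :
    v' 0 = sincereTop G i ∨ v' 0 = insincereTop G listing i := by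
  by_cases hs : v' 0 = sincereTop G i
  · exact Or.inl hs
  have hL : ∀ v ∈ listing i, v 0 ≠ sincereTop G i → IsLevelOne (plurality tb) G.profile i v := by
    intro v hv hne
    refine G.level_one ⟨i, hi⟩ v ?_ ?_
    · rw [← hplayer]
      simpa using hv
    · rintro rfl
      exact hne rfl
  have hmem : v' ∈ listing i := by
    rw [← hplayer] at hv'
    simpa using hv'
  rcases lastOtherTop_spec (G.profile i 0) (listing i) with h | ⟨hne, v'', hv'', e⟩
  · exact absurd (h.2 v' hmem) hs
  · right
    have h1 := hL v' hmem hs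
    have h2 := hL v'' hv'' (by rw [e]; exact hne)
    rw [insincereTop, ← e, ← (hi.2.level_one h1).1, ← (hi.2.level_one h2).1]
    exact h1.winner_unique h2

theorem sincereState
    (hplayer : ∀ i, (listing i.1).toFinset = G.strat i)
    (hnon : ∀ i : Fin n, ¬ (i ≠ 0 ∧ IsGSManipulator (plurality tb) G.profile i) → listing i = []) :
    SincereState (others n) (sincereTop G) (insincereTop G listing) (rank tb) (sincereTop G 0)
      (plurality tb G.profile) := by
  refine ⟨(plurality_eq_iff_wins _ _ _).1 rfl, fun i hi hne => ?_, fun i hi hne => ?_,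
    fun i hi hne => ?_⟩ <;> obtain ⟨h, v', hv', e, hl⟩ := insincereTop_spec hplayer hnon hne
  · exact h.2.top_ne_winner
  · rw [← e]
    exact (h.2.level_one hl).2.1
  · have := (h.2.level_one hl).2.2
    rwa [score_one, score_one, e] at this

/-- The top candidates of the submitted votes. -/
noncomputable def submittedTop (G : GSGame (n := n) (plurality tb))
    (s : ∀ i : {i : Fin n // G.IsPlayer i}, G.strategies i) (i : Fin n) : Fin m :=
  G.outcomeProfile s i 0

theorem winner_update_iff (s : ∀ i : {i : Fin n // G.IsPlayer i}, G.strategies i) (u : Vote m)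
    (x : Fin m) :
    plurality tb (G.outcomeProfile (Function.update s G.player1 (G.strategy1 u))) = x ↔
      Wins (rank tb) (u 0) (load (others n) (submittedTop G s)) x := by
  have h0 : G.outcomeProfile (Function.update s G.player1 (G.strategy1 u)) 0 = u := by
    have hp : G.IsPlayer 0 := Or.inl rfl
    rw [GSGame.outcomeProfile, dif_pos hp]
    change ((Function.update s G.player1 (G.strategy1 u) G.player1 : G.strategies _) : Vote m) = u
    rw [Function.update_self]
    rfl
  have hi : ∀ i : Fin n, i ≠ 0 →
      G.outcomeProfile (Function.update s G.player1 (G.strategy1 u)) i = G.outcomeProfile s i := by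
    intro i hi
    by_cases hp : G.IsPlayer i
    · rw [GSGame.outcomeProfile, GSGame.outcomeProfile, dif_pos hp, dif_pos hp,
        Function.update_of_ne]
      intro e
      exact hi (congrArg Subtype.val e)
    · rw [GSGame.outcomeProfile, GSGame.outcomeProfile, dif_neg hp, dif_neg hp]
  have hload : load (others n)
      (fun i => G.outcomeProfile (Function.update s G.player1 (G.strategy1 u)) i 0)
      = load (others n) (submittedTop G s) := by
    ext z
    rw [load, load]
    congr 1
    refine filter_congr fun i hio => ?_
    rw [hi i (mem_others.1 hio)]
    rfl
  rw [plurality_eq_iff_wins, h0, hload]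

theorem admissible_submittedTop
    (hplayer : ∀ i, (listing i.1).toFinset = G.strat i)
    (s : ∀ i : {i : Fin n // G.IsPlayer i}, G.strategies i) :
    Admissible (others n) (sincereTop G) (insincereTop G listing) (submittedTop G s) := by
  intro i hi
  have hi0 := mem_others.1 hi
  by_cases hp : G.IsPlayer i
  · rw [submittedTop, GSGame.outcomeProfile, dif_pos hp]
    exact top_of_mem_strat hplayer ⟨hi0, hp.resolve_left hi0⟩ ((s ⟨i, hp⟩).2 hi0)
  · left
    rw [submittedTop, GSGame.outcomeProfile, dif_neg hp]
    rfl

/-- Options are realised by the truthful vote or by a listed insincere one. Only the loads over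
`others n` are matched, as the entry at `0` is overwritten later. -/
theorem exists_submittedTop
    (hplayer : ∀ i, (listing i.1).toFinset = G.strat i)
    (hnon : ∀ i : Fin n, ¬ (i ≠ 0 ∧ IsGSManipulator (plurality tb) G.profile i) → listing i = [])
    {h : Fin n → Fin m}
    (hh : Admissible (others n) (sincereTop G) (insincereTop G listing) h) :
    ∃ s : ∀ i : {i : Fin n // G.IsPlayer i}, G.strategies i,
      load (others n) (submittedTop G s) = load (others n) h := by
  have hex : ∀ i : {i : Fin n // G.IsPlayer i}, ∃ v : G.strategies i,
      i.1 ≠ 0 → (v : Vote m) 0 = h i.1 := by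
    rintro ⟨i, hp⟩
    by_cases hi0 : i = 0
    · exact ⟨⟨G.profile i, fun hne => absurd hi0 hne⟩, fun hne => absurd hi0 hne⟩
    · have hsinc : G.profile i ∈ G.strategies ⟨i, hp⟩ := fun hne => G.truthful_mem _
      by_cases e : h i = sincereTop G i
      · exact ⟨⟨G.profile i, hsinc⟩, fun _ => e.symm⟩
      · have e' := (hh i (mem_others.2 hi0)).resolve_left e
        obtain ⟨hm, v', hv', hv, -⟩ := insincereTop_spec hplayer hnon (i := i)
          (by rw [← e']; exact e)
        exact ⟨⟨v', fun _ => hv'⟩, fun _ => hv.trans e'.symm⟩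
  choose s hs using hex
  refine ⟨s, funext fun z => ?_⟩
  rw [load, load]
  congr 1
  refine filter_congr fun i hi => ?_
  have hi0 := mem_others.1 hi
  suffices submittedTop G s i = h i by rw [this]
  by_cases hp : G.IsPlayer i
  · rw [submittedTop, GSGame.outcomeProfile, dif_pos hp]
    exact hs ⟨i, hp⟩ hi0
  · rw [submittedTop, GSGame.outcomeProfile, dif_neg hp]
    rcases hh i hi with e | e
    · exact e.symm
    -- A voter who is not a player has no listed strategies, so both options coincide.
    · by_cases e' : insincereTop G listing i = sincereTop G i
      · rw [e, e']; rfl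
      · obtain ⟨hm, -⟩ := insincereTop_spec hplayer hnon e'
        exact absurd (Or.inr hm.2) hp

/-- Some strategies of the other players make the vote for `a` worse than the vote for `b`. -/
def WorseSomewhere (G : GSGame (n := n) (plurality tb)) (listing : Fin n → List (Vote m))
    (a b : Fin m) : Prop :=
  ∃ x y, rank (G.profile 0) y < rank (G.profile 0) x ∧ ∃ X < n, ∃ Y < n,
    Criterion (others n) (sincereTop G) (insincereTop G listing) (rank tb) a b x y X Y

/-- Justifies the finite ranges of `X` and `Y` in `WorseSomewhere`, over which the machine searches.
-/
theorem load_others_lt (h : Fin n → Fin m) (z : Fin m) : load (others n) h z < n := by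
  have h1 : load (others n) h z ≤ (others n).card := card_filter_le _ _
  have h2 : (others n).card = n - 1 := by simp [others, card_erase_of_mem]
  have := NeZero.pos n
  omega

theorem worseSomewhere_iff
    (hplayer : ∀ i, (listing i.1).toFinset = G.strat i)
    (hnon : ∀ i : Fin n, ¬ (i ≠ 0 ∧ IsGSManipulator (plurality tb) G.profile i) → listing i = [])
    (u v : Vote m) :
    WorseSomewhere G listing (u 0) (v 0) ↔
      ∃ s : ∀ i : {i : Fin n // G.IsPlayer i}, G.strategies i,
        Prefers (G.profile 0)
          (plurality tb (G.outcomeProfile (Function.update s G.player1 (G.strategy1 v))))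
          (plurality tb (G.outcomeProfile (Function.update s G.player1 (G.strategy1 u)))) := by
  constructor
  · rintro ⟨x, y, hxy, X, -, Y, -, hc⟩
    have hne : x ≠ y := by
      rintro rfl
      exact lt_irrefl _ hxy
    obtain ⟨h, hh, hx, hy⟩ := hc.exists_admissible hne
    obtain ⟨s, hs⟩ := exists_submittedTop hplayer hnon hh
    refine ⟨s, ?_⟩
    rw [(winner_update_iff s u x).2 (hs ▸ hx), (winner_update_iff s v y).2 (hs ▸ hy)]
    exact hxy
  · rintro ⟨s, hs⟩
    refine ⟨_, _, hs, _, load_others_lt (submittedTop G s) _, _,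
      load_others_lt (submittedTop G s) _, (sincereState hplayer hnon).criterion
      (rank_injective tb) (admissible_submittedTop hplayer s) ?_
      ((winner_update_iff s u _).1 rfl) ((winner_update_iff s v _).1 rfl)⟩
    intro e
    rw [prefers_iff, e] at hs
    exact lt_irrefl _ hs

/-- Voter `0` has a linear order, so weak preference is the negation of the reverse strict
preference, and strict preference implies the weak one. -/
theorem dominates_iff
    (hplayer : ∀ i, (listing i.1).toFinset = G.strat i)
    (hnon : ∀ i : Fin n, ¬ (i ≠ 0 ∧ IsGSManipulator (plurality tb) G.profile i) → listing i = [])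
    (u v : Vote m) :
    G.Dominates u v ↔ ¬ WorseSomewhere G listing (u 0) (v 0) ∧
      WorseSomewhere G listing (v 0) (u 0) := by
  rw [worseSomewhere_iff hplayer hnon, worseSomewhere_iff hplayer hnon]
  have hweak : ∀ x y : Fin m, (Prefers (G.profile 0) x y ∨ x = y) ↔ ¬ Prefers (G.profile 0) y x := by
    intro x y
    rw [prefers_iff, prefers_iff]
    have := (rank_injective (G.profile 0)).eq_iff (a := x) (b := y)
    omega
  have hdom : G.Dominates u v ↔
      (∀ s : ∀ i : {i : Fin n // G.IsPlayer i}, G.strategies i,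
        (Prefers (G.profile 0)
          (plurality tb (G.outcomeProfile (Function.update s G.player1 (G.strategy1 u))))
          (plurality tb (G.outcomeProfile (Function.update s G.player1 (G.strategy1 v)))) ∨
          plurality tb (G.outcomeProfile (Function.update s G.player1 (G.strategy1 u)))
          = plurality tb (G.outcomeProfile (Function.update s G.player1 (G.strategy1 v))))) ∧
      ∃ s : ∀ i : {i : Fin n // G.IsPlayer i}, G.strategies i,
        (Prefers (G.profile 0)
          (plurality tb (G.outcomeProfile (Function.update s G.player1 (G.strategy1 u))))
          (plurality tb (G.outcomeProfile (Function.update s G.player1 (G.strategy1 v)))) ∨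
          plurality tb (G.outcomeProfile (Function.update s G.player1 (G.strategy1 u)))
          = plurality tb (G.outcomeProfile (Function.update s G.player1 (G.strategy1 v)))) ∧
        ¬ (Prefers (G.profile 0)
          (plurality tb (G.outcomeProfile (Function.update s G.player1 (G.strategy1 v))))
          (plurality tb (G.outcomeProfile (Function.update s G.player1 (G.strategy1 u)))) ∨
          plurality tb (G.outcomeProfile (Function.update s G.player1 (G.strategy1 v)))
          = plurality tb (G.outcomeProfile (Function.update s G.player1 (G.strategy1 u)))) :=
    Iff.rfl
  rw [hdom]
  simp only [hweak, not_not, not_exists]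
  refine and_congr_right fun _ => exists_congr fun s => ⟨And.right, fun h => ⟨?_, h⟩⟩
  rw [prefers_iff] at *
  omega

end Dominance

end Plurality

open Polynomial

/-! ### Execution of machine code -/

/-- The program `P` contains the instructions `L` from position `off` on. -/
def CodeAt (P : List Instr) : ℕ → List Instr → Prop
  | _, [] => True
  | off, q :: L => P[off]? = some q ∧ CodeAt P (off + 1) L

theorem codeAt_append {P : List Instr} {A B : List Instr} : ∀ {off : ℕ},
    CodeAt P off (A ++ B) ↔ CodeAt P off A ∧ CodeAt P (off + A.length) B := by
  induction A with
  | nil => intro off; simp [CodeAt]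
  | cons q A ih =>
    intro off
    simp only [List.cons_append, CodeAt, ih, List.length_cons, and_assoc]
    rw [show off + 1 + A.length = off + (A.length + 1) by omega]

theorem codeAt_self (A B : List Instr) : CodeAt (A ++ B) A.length B := by
  induction B generalizing A with
  | nil => trivial
  | cons q B ih =>
    refine ⟨by simp, ?_⟩
    have := ih (A ++ [q])
    simpa using this

/-- The program `P` leads from `c` to `c'` in at most `T` steps. -/
def Reaches (P : List Instr) (c c' : Config) (T : ℕ) : Prop := ∃ t ≤ T, (step P)^[t] c = c'

theorem Reaches.refl (P : List Instr) (c : Config) (T : ℕ) : Reaches P c c T :=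
  ⟨0, Nat.zero_le _, rfl⟩

theorem Reaches.trans {P : List Instr} {c c' c'' : Config} {T T' U : ℕ} (h : Reaches P c c' T)
    (h' : Reaches P c' c'' T') (hU : T + T' ≤ U) : Reaches P c c'' U := by
  obtain ⟨t, ht, e⟩ := h
  obtain ⟨t', ht', e'⟩ := h'
  exact ⟨t' + t, by omega, by rw [Function.iterate_add_apply, e, e']⟩

theorem Reaches.head {P : List Instr} {c c' : Config} {T U : ℕ} {q : Instr}
    (hq : P[c.pc]? = some q) (h : Reaches P (q.exec c) c' T) (hU : T + 1 ≤ U) :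
    Reaches P c c' U := by
  refine Reaches.trans (T := 1) ⟨1, le_rfl, ?_⟩ h (by omega)
  simp [step, hq]

theorem Reaches.headAt {P : List Instr} {c c' : Config} {p T U : ℕ} {q : Instr} (hp : c.pc = p)
    (hq : P[p]? = some q) (h : Reaches P (q.exec c) c' T) (hU : T + 1 ≤ U) : Reaches P c c' U :=
  Reaches.head (by rw [hp]; exact hq) h hU

/-! ### Expressions -/

/-- Arithmetic expressions over registers and memory. The summation index of a sum is a register,
and its number of terms is the value of a register. -/
inductive Expr where
  | var (r : ℕ)
  | num (a : ℕ)
  | add (e₁ e₂ : Expr)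
  | sub (e₁ e₂ : Expr)
  | mem (e : Expr)
  | ite (e e₁ e₂ : Expr)
  | sum (v b : ℕ) (e : Expr)

namespace Expr

/-- The value of an expression. -/
def eval : Expr → (ℕ → ℕ) → (ℕ → ℕ) → ℕ
  | var r, ρ, _ => ρ r
  | num a, _, _ => a
  | add e₁ e₂, ρ, μ => e₁.eval ρ μ + e₂.eval ρ μ
  | sub e₁ e₂, ρ, μ => e₁.eval ρ μ - e₂.eval ρ μ
  | mem e, ρ, μ => μ (e.eval ρ μ)
  | ite e e₁ e₂, ρ, μ => if 0 < e.eval ρ μ then e₁.eval ρ μ else e₂.eval ρ μ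
  | sum v b e, ρ, μ => ∑ i ∈ range (ρ b), e.eval (Function.update ρ v i) μ

/-- The registers `1`, `2` and `3` bound the number of iterations, and cannot be modified. -/
def WF (K : ℕ) : Expr → Prop
  | var r => r < K
  | num _ => True
  | add e₁ e₂ => e₁.WF K ∧ e₂.WF K
  | sub e₁ e₂ => e₁.WF K ∧ e₂.WF K
  | mem e => e.WF K
  | ite e e₁ e₂ => e.WF K ∧ e₁.WF K ∧ e₂.WF K
  | sum v b e => 4 ≤ v ∧ v < K ∧ 1 ≤ b ∧ b ≤ 3 ∧ e.WF K

/-- The length of the code. -/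
def len : Expr → ℕ
  | var _ => 2
  | num _ => 1
  | add e₁ e₂ => e₁.len + e₂.len + 1
  | sub e₁ e₂ => e₁.len + e₂.len + 1
  | mem e => e.len + 1
  | ite e e₁ e₂ => e.len + 1 + e₂.len + 2 + e₁.len
  | sum _ _ e => 9 + e.len + 7

/-- Code that computes the value of an expression in register `k`, without changing any register
below `k` or the memory, and that is placed at position `off`. -/
def code : Expr → ℕ → ℕ → List Instr
  | var r, k, _ => [.const k 0, .plus k r k]
  | num a, k, _ => [.const k a]
  | add e₁ e₂, k, off => e₁.code k off ++ (e₂.code (k + 1) (off + e₁.len) ++ [.plus k k (k + 1)])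
  | sub e₁ e₂, k, off => e₁.code k off ++ (e₂.code (k + 1) (off + e₁.len) ++ [.minus k k (k + 1)])
  | mem e, k, off => e.code k off ++ [.load k k]
  | ite e e₁ e₂, k, off =>
    e.code k off ++ ([.jumpPos k (off + e.len + 1 + e₂.len + 2)] ++
      (e₂.code k (off + e.len + 1) ++
        ([.const (k + 1) 1, .jumpPos (k + 1) (off + e.len + 1 + e₂.len + 2 + e₁.len)] ++
          e₁.code k (off + e.len + 1 + e₂.len + 2))))
  | sum v b e, k, off =>
    [.const k 0, .const (k + 1) 0, .plus (k + 1) v (k + 1), .const (k + 2) 0,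
      .plus (k + 2) b (k + 2), .const v 0, .jumpPos (k + 2) (off + 9), .const (k + 3) 1,
      .jumpPos (k + 3) (off + 9 + e.len + 5)] ++
    (e.code (k + 3) (off + 9) ++
      [.plus k k (k + 3), .const (k + 3) 1, .plus v v (k + 3), .minus (k + 2) (k + 2) (k + 3),
        .jumpPos (k + 3) (off + 6), .const v 0, .plus v v (k + 1)])

theorem length_code (e : Expr) : ∀ k off, (e.code k off).length = e.len := by
  induction e with
  | var | num => intros; rfl
  | add _ _ ih₁ ih₂ | sub _ _ ih₁ ih₂ =>
    intros; simp only [code, len, List.length_append, ih₁, ih₂, List.length_cons, List.length_nil]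
    omega
  | mem _ ih => intros; simp [code, len, ih]
  | ite _ _ _ ih ih₁ ih₂ =>
    intros
    simp only [code, len, List.length_append, ih, ih₁, ih₂, List.length_cons, List.length_nil]
    omega
  | sum _ _ _ ih =>
    intros; simp only [code, len, List.length_append, ih, List.length_cons, List.length_nil]
    omega

/-- A bound for the number of steps, in terms of a bound for the registers `1`, `2` and `3`. -/
noncomputable def cost : Expr → ℕ[X]
  | var _ => 2
  | num _ => 1
  | add e₁ e₂ => e₁.cost + e₂.cost + 1
  | sub e₁ e₂ => e₁.cost + e₂.cost + 1
  | mem e => e.cost + 1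
  | ite e e₁ e₂ => e.cost + e₁.cost + e₂.cost + 3
  | sum _ _ e => 11 + X * (e.cost + 6)

end Expr

/-- The registers that bound the number of iterations are at most `W`. -/
def BoundedBy (W : ℕ) (ρ : ℕ → ℕ) : Prop := ∀ b, 1 ≤ b → b ≤ 3 → ρ b ≤ W

theorem BoundedBy.update {W : ℕ} {ρ : ℕ → ℕ} (h : BoundedBy W ρ) {v : ℕ} (hv : 4 ≤ v) (a : ℕ) :
    BoundedBy W (Function.update ρ v a) := fun b h1 h3 => by
  rw [Function.update_of_ne (by omega)]
  exact h b h1 h3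

namespace Expr

/-- Variables live in registers below `K` and intermediate values from `k ≥ K` on. Since nothing
below `k` changes, subexpressions can be evaluated one after the other. -/
theorem code_correct {P : List Instr} {K W : ℕ} (e : Expr) : e.WF K → ∀ {k off : ℕ}, K ≤ k →
    CodeAt P off (e.code k off) → ∀ (c : Config) (ρ : ℕ → ℕ), c.pc = off →
    (∀ r < K, c.reg r = ρ r) → BoundedBy W ρ →
    ∃ c', Reaches P c c' (e.cost.eval W) ∧ c'.pc = off + e.len ∧ c'.reg k = e.eval ρ c.mem ∧
      (∀ r < k, c'.reg r = c.reg r) ∧ c'.mem = c.mem := by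
  induction e with
  | var r =>
    intro hwf k off hk hcode c ρ hpc hρ hb
    subst hpc
    obtain ⟨h1, h2, -⟩ := hcode
    have hr : r < K := hwf
    refine ⟨_, .head h1 (.head h2 (.refl _ _ 0) le_rfl) (by simp [cost]), rfl, ?_, ?_, rfl⟩
    · simp [Instr.exec, eval, show r ≠ k by omega, hρ r hr]
    · intro r' hr'
      simp [Instr.exec, show r' ≠ k by omega]
  | num a =>
    intro hwf k off hk hcode c ρ hpc hρ hb
    subst hpc
    obtain ⟨h1, -⟩ := hcode
    refine ⟨_, .head h1 (.refl _ _ 0) (by simp [cost]), rfl, by simp [Instr.exec, eval], ?_, rfl⟩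
    intro r' hr'
    simp [Instr.exec, show r' ≠ k by omega]
  | add e₁ e₂ ih₁ ih₂ =>
    intro hwf k off hk hcode c ρ hpc hρ hb
    simp only [code, codeAt_append, length_code] at hcode
    obtain ⟨hc1, hc2, h3, -⟩ := hcode
    obtain ⟨c1, hr1, hp1, hv1, hl1, hm1⟩ := ih₁ hwf.1 hk hc1 c ρ hpc hρ hb
    obtain ⟨c2, hr2, hp2, hv2, hl2, hm2⟩ := ih₂ hwf.2 (by omega) hc2 c1 ρ hp1
      (fun r hr => (hl1 r (by omega)).trans (hρ r hr)) hb
    rw [← hp2] at h3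
    refine ⟨_, hr1.trans (hr2.trans (.head h3 (.refl _ _ 0) le_rfl) le_rfl) ?_, ?_, ?_, ?_, ?_⟩
    · simp only [cost, eval_add, eval_one]; omega
    · simp only [Instr.exec, hp2, len]; omega
    · simp [Instr.exec, eval, hl2 k (by omega), hv1, hv2, hm1]
    · intro r hr
      simp [Instr.exec, show r ≠ k by omega, hl2 r (by omega), hl1 r hr]
    · simp [Instr.exec, hm1, hm2]
  | sub e₁ e₂ ih₁ ih₂ =>
    intro hwf k off hk hcode c ρ hpc hρ hb
    simp only [code, codeAt_append, length_code] at hcode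
    obtain ⟨hc1, hc2, h3, -⟩ := hcode
    obtain ⟨c1, hr1, hp1, hv1, hl1, hm1⟩ := ih₁ hwf.1 hk hc1 c ρ hpc hρ hb
    obtain ⟨c2, hr2, hp2, hv2, hl2, hm2⟩ := ih₂ hwf.2 (by omega) hc2 c1 ρ hp1
      (fun r hr => (hl1 r (by omega)).trans (hρ r hr)) hb
    rw [← hp2] at h3
    refine ⟨_, hr1.trans (hr2.trans (.head h3 (.refl _ _ 0) le_rfl) le_rfl) ?_, ?_, ?_, ?_, ?_⟩
    · simp only [cost, eval_add, eval_one]; omega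
    · simp only [Instr.exec, hp2, len]; omega
    · simp [Instr.exec, eval, hl2 k (by omega), hv1, hv2, hm1]
    · intro r hr
      simp [Instr.exec, show r ≠ k by omega, hl2 r (by omega), hl1 r hr]
    · simp [Instr.exec, hm1, hm2]
  | mem e ih =>
    intro hwf k off hk hcode c ρ hpc hρ hb
    simp only [code, codeAt_append, length_code] at hcode
    obtain ⟨hc1, h2, -⟩ := hcode
    obtain ⟨c1, hr1, hp1, hv1, hl1, hm1⟩ := ih hwf hk hc1 c ρ hpc hρ hb
    rw [← hp1] at h2
    refine ⟨_, hr1.trans (.head h2 (.refl _ _ 0) le_rfl) ?_, ?_, ?_, ?_, ?_⟩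
    · simp only [cost, eval_add, eval_one]; omega
    · simp only [Instr.exec, hp1, len]; omega
    · simp [Instr.exec, eval, hv1, hm1]
    · intro r hr
      simp [Instr.exec, show r ≠ k by omega, hl1 r hr]
    · simp [Instr.exec, hm1]
  | ite e e₁ e₂ ih ih₁ ih₂ =>
    intro hwf k off hk hcode c ρ hpc hρ hb
    simp only [code, codeAt_append, length_code, List.length_cons, List.length_nil] at hcode
    obtain ⟨hc, ⟨hj, -⟩, hc2, ⟨h3, h4, -⟩, hc1⟩ := hcode
    obtain ⟨c0, hr0, hp0, hv0, hl0, hm0⟩ := ih hwf.1 hk hc c ρ hpc hρ hb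
    have hj : P[c0.pc]? = some (.jumpPos k (off + e.len + 1 + e₂.len + 2)) := by rw [hp0]; exact hj
    have hρ0 : ∀ r < K, c0.reg r = ρ r := fun r hr => (hl0 r (by omega)).trans (hρ r hr)
    have hcost : (ite e e₁ e₂).cost.eval W
        = e.cost.eval W + e₁.cost.eval W + e₂.cost.eval W + 3 := by simp [cost]
    by_cases hpos : 0 < e.eval ρ c.mem
    · obtain ⟨c1, hr1, hp1, hv1, hl1, hm1⟩ := ih₁ hwf.2.1 hk hc1
        ((Instr.jumpPos k (off + e.len + 1 + e₂.len + 2)).exec c0) ρ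
        (by simp [Instr.exec, hv0, hpos]) hρ0 hb
      refine ⟨c1, hr0.trans (.head hj hr1 le_rfl) ?_, ?_, ?_, ?_, ?_⟩
      · omega
      · rw [hp1, len]; omega
      · simp [Instr.exec] at hv1
        simp [eval, hv1, hm0, hpos]
      · exact fun r hr => (hl1 r hr).trans (hl0 r hr)
      · exact hm1.trans hm0
    · obtain ⟨c1, hr1, hp1, hv1, hl1, hm1⟩ := ih₂ hwf.2.2 hk hc2
        ((Instr.jumpPos k (off + e.len + 1 + e₂.len + 2)).exec c0) ρ
        (by simp [Instr.exec, hv0, hpos, hp0]) hρ0 hb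
      rw [zero_add] at h3 h4
      refine ⟨_, hr0.trans (.head hj (hr1.trans (.headAt hp1 h3 (.headAt (by simp [Instr.exec, hp1])
        h4 (.refl _ _ 0) le_rfl) le_rfl) le_rfl) le_rfl) ?_, ?_, ?_, ?_, ?_⟩
      · omega
      · simp [Instr.exec, len]; omega
      · simp [Instr.exec] at hv1
        simp [Instr.exec, eval, hv1, hm0, hpos]
      · intro r hr
        simp only [Instr.exec] at hl1
        simp [Instr.exec, show r ≠ k + 1 by omega, hl1 r hr, hl0 r hr]
      · simp only [Instr.exec] at hm1 ⊢
        exact hm1.trans hm0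
  | sum v b e ih =>
    intro hwf k off hk hcode c ρ hpc hρ hb
    obtain ⟨hv4, hvK, hb1, hb3, hwf⟩ := hwf
    simp only [code, codeAt_append, length_code, List.length_cons, List.length_nil] at hcode
    obtain ⟨⟨i0, i1, i2, i3, i4, i5, i6, i7, i8, -⟩, hc, j0, j1, j2, j3, j4, j5, j6, -⟩ := hcode
    simp only [Nat.add_assoc, Nat.reduceAdd] at *
    -- `i` terms have been added into register `k` and `d` remain, counted down in `k + 2`. Register
    -- `k + 1` saves the old value of `v`, which is restored at the exit.
    have loop : ∀ (d i : ℕ) (c' : Config), i + d = ρ b → c'.pc = off + 6 → c'.reg (k + 2) = d →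
        c'.reg k = ∑ j ∈ range i, e.eval (Function.update ρ v j) c.mem →
        c'.reg (k + 1) = c.reg v → c'.reg v = i → (∀ r < k, r ≠ v → c'.reg r = c.reg r) →
        c'.mem = c.mem →
        ∃ c'', Reaches P c' c'' (d * (e.cost.eval W + 6) + 5) ∧ c''.pc = off + (e.len + 16) ∧
          c''.reg k = ∑ j ∈ range (ρ b), e.eval (Function.update ρ v j) c.mem ∧
          (∀ r < k, c''.reg r = c.reg r) ∧ c''.mem = c.mem := by
      intro d
      induction d with
      | zero =>
        intro i c' hi hp hd hacc hsave hvi hl hm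
        have n1 : c'.reg (k + 2) = 0 := hd
        refine ⟨_, .headAt hp i6 (.headAt (p := off + 7) ?_ i7 (.headAt (p := off + 8) ?_ i8
          (.headAt (p := off + (9 + (e.len + 5))) ?_ j5 (.headAt (p := off + (9 + (e.len + 6))) ?_ j6
          (.refl _ _ 0) le_rfl) le_rfl) le_rfl) le_rfl) ?_, ?_, ?_, ?_, ?_⟩
        · simp [Instr.exec, hp, n1]
        · simp [Instr.exec, hp, n1]
        · simp [Instr.exec]
        · simp [Instr.exec]; omega
        · omega
        · simp [Instr.exec]; omega
        · obtain rfl : i = ρ b := by omega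
          simp [Instr.exec, show k ≠ v by omega, hacc]
        · intro r hr
          by_cases e : r = v
          · subst e
            simp [Instr.exec, show k + 1 ≠ r by omega, hsave]
          · simp [Instr.exec, e, show r ≠ k + 3 by omega, hl r hr e]
        · simp [Instr.exec, hm]
      | succ d ihd =>
        intro i c' hi hp hd hacc hsave hvi hl hm
        obtain ⟨c1, hr1, hp1, hv1, hl1, hm1⟩ := ih hwf (k := k + 3) (by omega) hc
          ((Instr.jumpPos (k + 2) (off + 9)).exec c') (Function.update ρ v i)
          (by simp [Instr.exec, hd]) (fun r hr => by
            by_cases e : r = v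
            · subst e; simp [Instr.exec, hvi]
            · simp [Instr.exec, e, hl r (by omega) e, hρ r hr]) (hb.update hv4 i)
        simp only [Instr.exec] at hv1 hl1 hm1
        obtain ⟨c2, hr2, hp2, hv2, hl2, hm2⟩ := ihd (i + 1) ((Instr.jumpPos (k + 3) (off + 6)).exec
          ((Instr.minus (k + 2) (k + 2) (k + 3)).exec ((Instr.plus v v (k + 3)).exec
          ((Instr.const (k + 3) 1).exec ((Instr.plus k k (k + 3)).exec c1))))) (by omega)
          (by simp [Instr.exec, show k + 3 ≠ v by omega])
          (by simp [Instr.exec, show k + 2 ≠ v by omega, show k + 3 ≠ v by omega,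
            hl1 (k + 2) (by omega), hd])
          (by simp [Instr.exec, show k ≠ v by omega, hl1 k (by omega), hv1, hm, hacc,
            sum_range_succ])
          (by simp [Instr.exec, show k + 1 ≠ v by omega, hl1 (k + 1) (by omega), hsave])
          (by simp [Instr.exec, show v ≠ k + 2 by omega, show v ≠ k + 3 by omega,
            show v ≠ k by omega, hl1 v (by omega), hvi])
          (fun r hr hne => by simp [Instr.exec, show r ≠ k + 2 by omega, show r ≠ k + 3 by omega,
            show r ≠ k by omega, hne, hl1 r (by omega), hl r hr hne])
          (by simp [Instr.exec, hm1, hm])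
        refine ⟨c2, .headAt hp i6 (hr1.trans (.headAt (p := off + (9 + e.len)) ?_ j0
          (.headAt (p := off + (9 + (e.len + 1))) ?_ j1 (.headAt (p := off + (9 + (e.len + 2))) ?_ j2
          (.headAt (p := off + (9 + (e.len + 3))) ?_ j3 (.headAt (p := off + (9 + (e.len + 4))) ?_ j4
          hr2 le_rfl) le_rfl) le_rfl) le_rfl) le_rfl) le_rfl) ?_, hp2, hv2, hl2, hm2⟩
        · simp only [hp1]; omega
        · simp [Instr.exec, hp1]; omega
        · simp [Instr.exec, hp1]; omega
        · simp [Instr.exec, hp1]; omega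
        · simp [Instr.exec, hp1]; omega
        · rw [Nat.add_mul]; omega
    obtain ⟨c2, hr2, hp2, hv2, hl2, hm2⟩ := loop (ρ b) 0 ((Instr.const v 0).exec
      ((Instr.plus (k + 2) b (k + 2)).exec ((Instr.const (k + 2) 0).exec
      ((Instr.plus (k + 1) v (k + 1)).exec ((Instr.const (k + 1) 0).exec
      ((Instr.const k 0).exec c)))))) (by omega) (by simp [Instr.exec, hpc])
      (by simp [Instr.exec, show k + 2 ≠ v by omega, show b ≠ k + 2 by omega,
        show b ≠ k + 1 by omega, show b ≠ k by omega, hρ b (by omega)])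
      (by simp [Instr.exec, show k ≠ v by omega])
      (by simp [Instr.exec, show k + 1 ≠ v by omega, show v ≠ k + 1 by omega,
        show v ≠ k by omega])
      (by simp [Instr.exec])
      (fun r hr hne => by simp [Instr.exec, hne, show r ≠ k + 2 by omega,
        show r ≠ k + 1 by omega, show r ≠ k by omega])
      (by simp [Instr.exec])
    have hcost : (ρ b) * (e.cost.eval W + 6) ≤ W * (e.cost.eval W + 6) :=
      Nat.mul_le_mul_right _ (hb b hb1 hb3)
    refine ⟨c2, .headAt hpc i0 (.headAt (p := off + 1) ?_ i1 (.headAt (p := off + 2) ?_ i2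
      (.headAt (p := off + 3) ?_ i3 (.headAt (p := off + 4) ?_ i4 (.headAt (p := off + 5) ?_ i5
      hr2 le_rfl) le_rfl) le_rfl) le_rfl) le_rfl) ?_, ?_, hv2, hl2, hm2⟩
    · simp [Instr.exec, hpc]
    · simp [Instr.exec, hpc]
    · simp [Instr.exec, hpc]
    · simp [Instr.exec, hpc]
    · simp [Instr.exec, hpc]
    · simp [cost]; omega
    · rw [hp2, len]; omega

end Expr

/-! ### Commands -/

/-- The registers and the memory. -/
structure Store where
  reg : ℕ → ℕ
  mem : ℕ → ℕ

/-- Programs with bounded loops. The number of iterations of a loop is the value of a register. -/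
inductive Cmd where
  | assign (r : ℕ) (e : Expr)
  | store (e₁ e₂ : Expr)
  | seq (p q : Cmd)
  | loop (v b : ℕ) (p : Cmd)

namespace Cmd

/-- The effect of a command. -/
def run : Cmd → Store → Store
  | assign r e, s => { s with reg := Function.update s.reg r (e.eval s.reg s.mem) }
  | store e₁ e₂, s =>
    { s with mem := Function.update s.mem (e₁.eval s.reg s.mem) (e₂.eval s.reg s.mem) }
  | seq p q, s => q.run (p.run s)
  | loop v b p, s =>
    (fun s' : Store =>
      { p.run s' with reg := Function.update (p.run s').reg v ((p.run s').reg v + 1) })^[s.reg b]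
      { s with reg := Function.update s.reg v 0 }

/-- The registers `1`, `2` and `3` bound the number of iterations, and cannot be modified. -/
def WF (K : ℕ) : Cmd → Prop
  | assign r e => (r = 0 ∨ 4 ≤ r) ∧ r < K ∧ e.WF K
  | store e₁ e₂ => e₁.WF K ∧ e₂.WF K
  | seq p q => p.WF K ∧ q.WF K
  | loop v b p => 4 ≤ v ∧ v < K ∧ 1 ≤ b ∧ b ≤ 3 ∧ p.WF K

/-- The length of the code. -/
def len : Cmd → ℕ
  | assign _ e => e.len + 2
  | store e₁ e₂ => e₁.len + e₂.len + 1
  | seq p q => p.len + q.len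
  | loop _ _ p => 6 + p.len + 4

/-- Code for a command, placed at position `off`, that uses the registers from `k` on for
intermediate values. -/
def code : Cmd → ℕ → ℕ → List Instr
  | assign r e, k, off => e.code k off ++ [.const r 0, .plus r r k]
  | store e₁ e₂, k, off =>
    e₁.code k off ++ (e₂.code (k + 1) (off + e₁.len) ++ [.store k (k + 1)])
  | seq p q, k, off => p.code k off ++ q.code k (off + p.len)
  | loop v b p, k, off =>
    [.const k 0, .plus k b k, .const v 0, .jumpPos k (off + 6), .const (k + 1) 1,
      .jumpPos (k + 1) (off + 6 + p.len + 4)] ++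
    (p.code (k + 1) (off + 6) ++
      [.const (k + 1) 1, .plus v v (k + 1), .minus k k (k + 1), .jumpPos (k + 1) (off + 3)])

theorem length_code (p : Cmd) : ∀ k off, (p.code k off).length = p.len := by
  induction p with
  | assign => intros; simp [code, len, Expr.length_code]
  | store =>
    intros
    simp only [code, len, List.length_append, Expr.length_code, List.length_cons, List.length_nil]
    omega
  | seq _ _ ih₁ ih₂ => intros; simp [code, len, ih₁, ih₂]
  | loop _ _ _ ih =>
    intros; simp only [code, len, List.length_append, ih, List.length_cons, List.length_nil]
    omega

/-- A bound for the number of steps, in terms of a bound for the registers `1`, `2` and `3`. -/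
noncomputable def cost : Cmd → ℕ[X]
  | assign _ e => e.cost + 2
  | store e₁ e₂ => e₁.cost + e₂.cost + 1
  | seq p q => p.cost + q.cost
  | loop _ _ p => 6 + X * (p.cost + 5)

/-- The rule for loop invariants; `J i` speaks about the state before iteration `i`, after the
increment of the counter. -/
theorem run_loop_induction {v b : ℕ} {p : Cmd} {s : Store} (J : ℕ → Store → Prop)
    (h0 : J 0 { s with reg := Function.update s.reg v 0 })
    (hs : ∀ i s', i < s.reg b → J i s' →
      J (i + 1) { p.run s' with reg := Function.update (p.run s').reg v ((p.run s').reg v + 1) }) :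
    J (s.reg b) ((loop v b p).run s) := by
  have : ∀ d ≤ s.reg b, J d ((fun s' : Store =>
      { p.run s' with reg := Function.update (p.run s').reg v ((p.run s').reg v + 1) })^[d]
      { s with reg := Function.update s.reg v 0 }) := by
    intro d
    induction d with
    | zero => exact fun _ => h0
    | succ d ih =>
      intro hd
      rw [Function.iterate_succ_apply']
      exact hs d _ (by omega) (ih (by omega))
  exact this _ le_rfl

/-- Keeps all iteration bounds fixed during a run, so that `cost` can be a polynomial in one number.
-/
theorem run_reg_protected {K : ℕ} (p : Cmd) (hp : p.WF K) {r : ℕ} (h1 : 1 ≤ r) (h3 : r ≤ 3) :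
    ∀ s : Store, (p.run s).reg r = s.reg r := by
  induction p with
  | assign r' e =>
    intro s
    exact Function.update_of_ne (by have := hp.1; omega) _ _
  | store => exact fun s => rfl
  | seq p q ih₁ ih₂ => exact fun s => (ih₂ hp.2 _).trans (ih₁ hp.1 s)
  | loop v b p ih =>
    intro s
    obtain ⟨hv4, -, -, -, hp⟩ := hp
    refine run_loop_induction (fun _ s' => s'.reg r = s.reg r) ?_ ?_
    · exact Function.update_of_ne (by omega) _ _
    · intro i s' _ h
      exact (Function.update_of_ne (by omega) _ _).trans ((ih hp s').trans h)

theorem boundedBy_run {K W : ℕ} {p : Cmd} (hp : p.WF K) {s : Store} (h : BoundedBy W s.reg) :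
    BoundedBy W (p.run s).reg := fun b h1 h3 => by
  rw [run_reg_protected p hp h1 h3]
  exact h b h1 h3

/-- The last conjunct protects the hidden counters of enclosing loops: a loop keeps its counter in
register `k` and compiles its body with `k + 1`. -/
theorem code_correct {P : List Instr} {K W : ℕ} (p : Cmd) : p.WF K → ∀ {k off : ℕ}, K ≤ k →
    CodeAt P off (p.code k off) → ∀ (c : Config) (s : Store), c.pc = off →
    (∀ r < K, c.reg r = s.reg r) → c.mem = s.mem → BoundedBy W s.reg →
    ∃ c', Reaches P c c' (p.cost.eval W) ∧ c'.pc = off + p.len ∧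
      (∀ r < K, c'.reg r = (p.run s).reg r) ∧ c'.mem = (p.run s).mem ∧
      ∀ r < k, K ≤ r → c'.reg r = c.reg r := by
  induction p with
  | assign r e =>
    intro hwf k off hk hcode c s hpc hρ hμ hb
    simp only [code, codeAt_append, Expr.length_code] at hcode
    obtain ⟨hc, i0, i1, -⟩ := hcode
    obtain ⟨c1, hr1, hp1, hv1, hl1, hm1⟩ := e.code_correct hwf.2.2 hk hc c s.reg hpc hρ hb
    have hrK : r < K := hwf.2.1
    refine ⟨_, hr1.trans (.headAt hp1 i0 (.headAt (by simp [Instr.exec, hp1]) i1 (.refl _ _ 0)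
      le_rfl) le_rfl) ?_, ?_, ?_, ?_, ?_⟩
    · simp [cost]
    · simp [Instr.exec, hp1, len]; omega
    · intro r' hr'
      by_cases e : r' = r
      · subst e
        simp [Instr.exec, run, show k ≠ r' by omega, hv1, hμ]
      · simp [Instr.exec, run, e, hl1 r' (by omega), hρ r' hr']
    · simp [Instr.exec, run, hm1, hμ]
    · intro r' hr' hK
      simp [Instr.exec, show r' ≠ r by omega, hl1 r' hr']
  | store e₁ e₂ =>
    intro hwf k off hk hcode c s hpc hρ hμ hb
    simp only [code, codeAt_append, Expr.length_code] at hcode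
    obtain ⟨hc1, hc2, i0, -⟩ := hcode
    obtain ⟨c1, hr1, hp1, hv1, hl1, hm1⟩ := e₁.code_correct hwf.1 hk hc1 c s.reg hpc hρ hb
    obtain ⟨c2, hr2, hp2, hv2, hl2, hm2⟩ := e₂.code_correct hwf.2 (k := k + 1) (by omega) hc2 c1
      s.reg hp1 (fun r hr => (hl1 r (by omega)).trans (hρ r hr)) hb
    refine ⟨_, hr1.trans (hr2.trans (.headAt hp2 i0 (.refl _ _ 0) le_rfl) le_rfl) ?_, ?_, ?_, ?_,
      ?_⟩
    · simp [cost]; omega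
    · simp [Instr.exec, hp2, len]; omega
    · intro r hr
      simp [Instr.exec, run, hl2 r (by omega), hl1 r (by omega), hρ r hr]
    · simp [Instr.exec, run, hm2, hm1, hμ, hl2 k (by omega), hv1, hv2]
    · intro r hr hK
      simp [Instr.exec, hl2 r (by omega), hl1 r hr]
  | seq p q ih₁ ih₂ =>
    intro hwf k off hk hcode c s hpc hρ hμ hb
    simp only [code, codeAt_append, length_code] at hcode
    obtain ⟨c1, hr1, hp1, hv1, hm1, hl1⟩ := ih₁ hwf.1 hk hcode.1 c s hpc hρ hμ hb
    obtain ⟨c2, hr2, hp2, hv2, hm2, hl2⟩ := ih₂ hwf.2 hk hcode.2 c1 (p.run s) hp1 hv1 hm1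
      (boundedBy_run hwf.1 hb)
    refine ⟨c2, hr1.trans hr2 ?_, ?_, hv2, hm2, fun r hr hK => (hl2 r hr hK).trans (hl1 r hr hK)⟩
    · simp [cost]
    · rw [hp2, len]; omega
  | loop v b p ih =>
    intro hwf k off hk hcode c s hpc hρ hμ hb
    obtain ⟨hv4, hvK, hb1, hb3, hwf⟩ := hwf
    simp only [code, codeAt_append, length_code, List.length_cons, List.length_nil] at hcode
    obtain ⟨⟨i0, i1, i2, i3, i4, i5, -⟩, hc, j0, j1, j2, j3, -⟩ := hcode
    simp only [Nat.add_assoc, Nat.reduceAdd] at *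
    have loop : ∀ (d : ℕ) (c' : Config) (s' : Store), c'.pc = off + 3 → c'.reg k = d →
        (∀ r < K, c'.reg r = s'.reg r) → c'.mem = s'.mem → BoundedBy W s'.reg →
        (∀ r < k, K ≤ r → c'.reg r = c.reg r) →
        ∃ c'', Reaches P c' c'' (d * (p.cost.eval W + 5) + 3) ∧ c''.pc = off + (p.len + 10) ∧
          (∀ r < K, c''.reg r = ((fun s' : Store =>
            { p.run s' with reg := Function.update (p.run s').reg v ((p.run s').reg v + 1) })^[d]
            s').reg r) ∧
          c''.mem = ((fun s' : Store =>
            { p.run s' with reg := Function.update (p.run s').reg v ((p.run s').reg v + 1) })^[d]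
            s').mem ∧
          ∀ r < k, K ≤ r → c''.reg r = c.reg r := by
      intro d
      induction d with
      | zero =>
        intro c' s' hp hd hρ' hμ' hb' hl'
        refine ⟨_, .headAt hp i3 (.headAt (p := off + 4) ?_ i4 (.headAt (p := off + 5) ?_ i5
          (.refl _ _ 0) le_rfl) le_rfl) ?_, ?_, ?_, ?_, ?_⟩
        · simp [Instr.exec, hp, hd]
        · simp [Instr.exec, hp, hd]
        · omega
        · simp [Instr.exec]; omega
        · intro r hr
          simp [Instr.exec, show r ≠ k + 1 by omega, hρ' r hr]
        · simp [Instr.exec, hμ']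
        · intro r hr hK
          simp [Instr.exec, show r ≠ k + 1 by omega, hl' r hr hK]
      | succ d ihd =>
        intro c' s' hp hd hρ' hμ' hb' hl'
        obtain ⟨c1, hr1, hp1, hv1, hm1, hl1⟩ := ih hwf (k := k + 1) (by omega) hc
          ((Instr.jumpPos k (off + 6)).exec c') s' (by simp [Instr.exec, hd])
          (fun r hr => by simp [Instr.exec, hρ' r hr]) (by simp [Instr.exec, hμ']) hb'
        simp only [Instr.exec] at hl1
        obtain ⟨c2, hr2, hp2, hv2, hm2, hl2⟩ := ihd ((Instr.jumpPos (k + 1) (off + 3)).exec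
          ((Instr.minus k k (k + 1)).exec ((Instr.plus v v (k + 1)).exec
          ((Instr.const (k + 1) 1).exec c1))))
          { p.run s' with reg := Function.update (p.run s').reg v ((p.run s').reg v + 1) }
          (by simp [Instr.exec, show k + 1 ≠ v by omega])
          (by simp [Instr.exec, show k + 1 ≠ v by omega, show k ≠ v by omega,
            hl1 k (by omega) hk, hd])
          (fun r hr => by
            by_cases e : r = v
            · subst e
              simp [Instr.exec, show r ≠ k by omega, show r ≠ k + 1 by omega, hv1 r hr]
            · simp [Instr.exec, e, show r ≠ k by omega, show r ≠ k + 1 by omega, hv1 r hr])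
          (by simp [Instr.exec, hm1]) ((boundedBy_run hwf hb').update hv4 _)
          (fun r hr hK => by simp [Instr.exec, show r ≠ k by omega, show r ≠ k + 1 by omega,
            show r ≠ v by omega, hl1 r (by omega) hK, hl' r hr hK])
        refine ⟨c2, .headAt hp i3 (hr1.trans (.headAt (p := off + (6 + p.len)) ?_ j0
          (.headAt (p := off + (6 + (p.len + 1))) ?_ j1 (.headAt (p := off + (6 + (p.len + 2))) ?_ j2
          (.headAt (p := off + (6 + (p.len + 3))) ?_ j3 hr2 le_rfl) le_rfl) le_rfl) le_rfl) le_rfl) ?_,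
          hp2, hv2, hm2, hl2⟩
        · simp only [hp1]; omega
        · simp [Instr.exec, hp1]; omega
        · simp [Instr.exec, hp1]; omega
        · simp [Instr.exec, hp1]; omega
        · rw [Nat.add_mul]; omega
    obtain ⟨c2, hr2, hp2, hv2, hm2, hl2⟩ := loop (s.reg b) ((Instr.const v 0).exec
      ((Instr.plus k b k).exec ((Instr.const k 0).exec c)))
      { s with reg := Function.update s.reg v 0 } (by simp [Instr.exec, hpc])
      (by simp [Instr.exec, show k ≠ v by omega, show b ≠ k by omega, hρ b (by omega)])
      (fun r hr => by
        by_cases e : r = v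
        · subst e
          simp [Instr.exec]
        · simp [Instr.exec, e, show r ≠ k by omega, hρ r hr])
      (by simp [Instr.exec, hμ]) (hb.update hv4 _)
      (fun r hr hK => by simp [Instr.exec, show r ≠ k by omega, show r ≠ v by omega])
    have hcost : (s.reg b) * (p.cost.eval W + 5) ≤ W * (p.cost.eval W + 5) :=
      Nat.mul_le_mul_right _ (hb b hb1 hb3)
    refine ⟨c2, .headAt hpc i0 (.headAt (p := off + 1) ?_ i1 (.headAt (p := off + 2) ?_ i2
      hr2 le_rfl) le_rfl) ?_, ?_, hv2, hm2, hl2⟩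
    · simp [Instr.exec, hpc]
    · simp [Instr.exec, hpc]
    · simp [cost]; omega
    · rw [hp2, len]; omega

end Cmd

/-! ### Logical and arithmetical expressions -/

namespace Expr

/-- An expression used as a condition is true if its value is positive. -/
def Holds (e : Expr) (ρ μ : ℕ → ℕ) : Prop := 0 < e.eval ρ μ

/-- As truth is positivity, disjunction is addition, `<` is truncated subtraction, and a bounded
existential quantifier is a sum. -/
def not (e : Expr) : Expr := ite e (num 0) (num 1)
def and (e f : Expr) : Expr := ite e f (num 0)
def or (e f : Expr) : Expr := add e f
def imp (e f : Expr) : Expr := ite e f (num 1)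
def lt (e f : Expr) : Expr := sub f e
def le (e f : Expr) : Expr := not (lt f e)
def eq (e f : Expr) : Expr := not (or (lt e f) (lt f e))
def ex (v b : ℕ) (e : Expr) : Expr := sum v b e
def ind (e : Expr) : Expr := ite e (num 1) (num 0)

variable {e f : Expr} {ρ μ : ℕ → ℕ}

theorem holds_not : (not e).Holds ρ μ ↔ ¬ e.Holds ρ μ := by
  by_cases h : 0 < e.eval ρ μ <;> simp [Holds, not, eval, h]

theorem holds_and : (and e f).Holds ρ μ ↔ e.Holds ρ μ ∧ f.Holds ρ μ := by
  by_cases h : 0 < e.eval ρ μ <;> simp [Holds, and, eval, h]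

theorem holds_or : (or e f).Holds ρ μ ↔ e.Holds ρ μ ∨ f.Holds ρ μ := by
  simp only [Holds, or, eval]; omega

theorem holds_imp : (imp e f).Holds ρ μ ↔ (e.Holds ρ μ → f.Holds ρ μ) := by
  by_cases h : 0 < e.eval ρ μ <;> simp [Holds, imp, eval, h]

theorem holds_lt : (lt e f).Holds ρ μ ↔ e.eval ρ μ < f.eval ρ μ := by
  simp only [Holds, lt, eval]; omega

theorem holds_le : (le e f).Holds ρ μ ↔ e.eval ρ μ ≤ f.eval ρ μ := by
  rw [le, holds_not, holds_lt, not_lt]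

theorem holds_eq : (eq e f).Holds ρ μ ↔ e.eval ρ μ = f.eval ρ μ := by
  rw [eq, holds_not, holds_or, holds_lt, holds_lt]; omega

theorem holds_ex {v b : ℕ} :
    (ex v b e).Holds ρ μ ↔ ∃ i < ρ b, e.Holds (Function.update ρ v i) μ := by
  simp [Holds, ex, eval, sum_pos_iff]

open Classical in
theorem eval_ite_holds {e₁ e₂ : Expr} :
    (ite e e₁ e₂).eval ρ μ = if e.Holds ρ μ then e₁.eval ρ μ else e₂.eval ρ μ := by
  simp only [eval, Holds]
  congr

theorem eval_var {r : ℕ} : (var r).eval ρ μ = ρ r := rfl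

theorem eval_num {a : ℕ} : (num a).eval ρ μ = a := rfl

theorem eval_add : (add e f).eval ρ μ = e.eval ρ μ + f.eval ρ μ := rfl

theorem eval_sub : (sub e f).eval ρ μ = e.eval ρ μ - f.eval ρ μ := rfl

theorem eval_mem : (mem e).eval ρ μ = μ (e.eval ρ μ) := rfl

open Classical in
theorem eval_ind : (ind e).eval ρ μ = if e.Holds ρ μ then 1 else 0 := eval_ite_holds

/-- The cell `e` of the array number `k`; the arrays have the length of the input. -/
def cell : ℕ → Expr → Expr
  | 0, e => e
  | k + 1, e => add (var 3) (cell k e)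

theorem eval_cell (k : ℕ) : (cell k e).eval ρ μ = k * ρ 3 + e.eval ρ μ := by
  induction k with
  | zero => simp [cell]
  | succ k ih => simp only [cell, eval, ih]; ring

/-- `Beats` for expressions. -/
def beats (k p k' p' : Expr) : Expr := or (lt k' k) (and (eq k' k) (lt p p'))

theorem holds_beats {k p k' p' : Expr} : (beats k p k' p').Holds ρ μ ↔
    Beats (k.eval ρ μ) (p.eval ρ μ) (k'.eval ρ μ) (p'.eval ρ μ) := by
  rw [beats, holds_or, holds_and, holds_lt, holds_lt, holds_eq, Beats]

/-- The position of the candidate in register `z` in the vote at address `base`. -/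
def rankAt (base : Expr) (z : ℕ) : Expr :=
  sum 17 2 (ite (eq (mem (add base (var 17))) (var z)) (var 17) (num 0))

/-- The address of the tie-breaking order. -/
def tieBreaking : Expr := num 2

/-- The address of the sincere vote of the distinguished voter. -/
def sincereVote : Expr := add (num 2) (var 2)

/-- The sincere top candidate of the voter in register `16`. -/
def firstOption : Expr := mem (cell 1 (var 16))

/-- The other top candidate of the voter in register `16`. -/
def secondOption : Expr := mem (cell 2 (var 16))

/-- The number of other voters whose top candidate is in register `z`. -/
def sincereLoad (z : ℕ) : Expr := sum 16 1 (ind (and (var 16) (eq firstOption (var z))))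

/-- The candidate in register `z` is an option of the voter in register `16`. -/
def isOption (z : ℕ) : Expr := or (eq firstOption (var z)) (eq secondOption (var z))

/-- The conjunct `var 16` fails exactly for voter `0`, who is thereby left out of the count. -/
def countOption (z : ℕ) : Expr := sum 16 1 (ind (and (var 16) (isOption z)))

def countOption₂ (x y : ℕ) : Expr := sum 16 1 (ind (and (var 16) (or (isOption x) (isOption y))))

/-- `Compatible` for the candidates in the registers `a`, `b`, `11`, `12` and `z`, the scores in the
registers `13` and `14`, and the score `k`. -/
def compatible (a b z : ℕ) (k : Expr) : Expr :=
  and (imp (eq (var z) (var 11)) (le k (var 13)))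
  (and (imp (eq (var z) (var 12)) (le k (var 14)))
  (and (imp (not (eq (var z) (var 11)))
    (beats (add (var 13) (ind (eq (var a) (var 11)))) (rankAt tieBreaking 11)
      (add k (ind (eq (var a) (var z)))) (rankAt tieBreaking z)))
  (imp (not (eq (var z) (var 12)))
    (beats (add (var 14) (ind (eq (var b) (var 12)))) (rankAt tieBreaking 12)
      (add k (ind (eq (var b) (var z)))) (rankAt tieBreaking z)))))

def countViolations (a b : ℕ) : Expr :=
  sum 15 2 (add (ite (compatible a b 15 (sincereLoad 15)) (num 0) (num 1))
    (ite (compatible a b 15 (sub (sincereLoad 15) (num 1))) (num 0) (num 1)))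

/-- `Criterion` for the candidates in the registers `a`, `b`, `11` and `12` and the scores in the
registers `13` and `14`; the arrays with the numbers `ka` and `kb` hold the candidates that are
reached from the candidates in the registers `a` and `b`. -/
def criterion (a b ka kb : ℕ) : Expr :=
  and (compatible a b 11 (var 13)) (and (compatible a b 12 (var 14))
  (and (le (var 13) (countOption 11)) (and (le (var 14) (countOption 12))
  (and (le (add (var 13) (var 14)) (countOption₂ 11 12))
  (or (eq (countViolations a b) (num 0)) (and (eq (countViolations a b) (num 1))
    (ex 15 2 (and (compatible a b 15 (add (sincereLoad 15) (num 1)))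
      (or (and (not (compatible a b a (sincereLoad a))) (mem (cell ka (var 15))))
        (and (not (compatible a b b (sincereLoad b))) (mem (cell kb (var 15)))))))))))))

/-- `WorseSomewhere` for the candidates in the registers `a` and `b`. -/
def worseSomewhere (a b ka kb : ℕ) : Expr :=
  ex 11 2 (ex 12 2 (and (lt (rankAt sincereVote 12) (rankAt sincereVote 11))
    (ex 13 1 (ex 14 1 (criterion a b ka kb)))))

end Expr

/-! ### Values of the expressions when the memory holds the options. -/

section Layout

variable {n m : ℕ} [NeZero n] [NeZero m]

/-- The memory holds the tie-breaking order `tb` and the sincere vote `v` of the distinguished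
voter in the input, and the options `t` and `c` of the voters in the arrays `1` and `2`. -/
structure Layout (tb v : Vote m) (t c : Fin n → Fin m) (ρ μ : ℕ → ℕ) : Prop where
  reg1 : ρ 1 = n
  reg2 : ρ 2 = m
  tieBreaking : ∀ q : Fin m, μ (2 + q) = tb q
  sincereVote : ∀ q : Fin m, μ (2 + m + q) = v q
  first : ∀ i : Fin n, μ (1 * ρ 3 + i) = t i
  second : ∀ i : Fin n, μ (2 * ρ 3 + i) = c i

variable {tb v : Vote m} {t c : Fin n → Fin m} {ρ μ : ℕ → ℕ}

theorem Layout.update (H : Layout tb v t c ρ μ) {r : ℕ} (hr : 4 ≤ r) (a : ℕ) :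
    Layout tb v t c (Function.update ρ r a) μ := by
  obtain ⟨h1, h2, h3, h4, h5, h6⟩ := H
  have e1 : Function.update ρ r a 1 = ρ 1 := Function.update_of_ne (by omega) _ _
  have e2 : Function.update ρ r a 2 = ρ 2 := Function.update_of_ne (by omega) _ _
  have e3 : Function.update ρ r a 3 = ρ 3 := Function.update_of_ne (by omega) _ _
  exact ⟨e1 ▸ h1, e2 ▸ h2, h3, h4, e3 ▸ h5, e3 ▸ h6⟩

/-- Only the position of `z` contributes; this is how `rankAt` inverts a vote. -/
theorem sum_rank (w : Vote m) (z : Fin m) {f : ℕ → ℕ} (hf : ∀ q : Fin m, f q = w q) :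
    (∑ q ∈ range m, if f q = z then q else 0) = rank w z := by
  rw [Finset.sum_range, sum_eq_single (w.symm z)]
  · rw [hf, Equiv.apply_symm_apply, if_pos rfl, rank]
  · intro q _ hq
    rw [if_neg]
    rw [hf, Fin.val_inj]
    rintro rfl
    exact hq (w.symm_apply_apply q).symm
  · exact fun h => absurd (mem_univ _) h

theorem Layout.eval_rankAt (H : Layout tb v t c ρ μ) (w : Vote m) {base : Expr} {B : ℕ}
    (hB : ∀ i, base.eval (Function.update ρ 17 i) μ = B) (hw : ∀ q : Fin m, μ (B + q) = w q)
    {r : ℕ} (hr : r ≠ 17) {z : Fin m} (hz : ρ r = z) :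
    (Expr.rankAt base r).eval ρ μ = rank w z := by
  classical
  rw [← sum_rank w z (f := fun q => μ (B + q)) hw, Expr.rankAt, Expr.eval, H.reg2]
  refine sum_congr rfl fun q _ => ?_
  rw [Expr.eval_ite_holds, Expr.holds_eq]
  simp [Expr.eval, hB, hr, hz]

theorem Layout.eval_rank_tieBreaking (H : Layout tb v t c ρ μ) {r : ℕ} (hr : r ≠ 17) {z : Fin m}
    (hz : ρ r = z) : (Expr.rankAt Expr.tieBreaking r).eval ρ μ = rank tb z :=
  H.eval_rankAt tb (fun _ => rfl) H.tieBreaking hr hz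

theorem Layout.eval_rank_sincereVote (H : Layout tb v t c ρ μ) {r : ℕ} (hr : r ≠ 17) {z : Fin m}
    (hz : ρ r = z) : (Expr.rankAt Expr.sincereVote r).eval ρ μ = rank v z :=
  H.eval_rankAt v (B := 2 + m) (fun _ => by simp [Expr.sincereVote, Expr.eval, H.reg2])
    H.sincereVote hr hz

theorem Layout.eval_count (H : Layout tb v t c ρ μ) {e : Expr} {p : Fin n → Prop}
    [DecidablePred p] (he : ∀ i : Fin n, e.Holds (Function.update ρ 16 i) μ ↔ p i) :
    (Expr.sum 16 1 (.ind (.and (.var 16) e))).eval ρ μ = ((others n).filter p).card := by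
  classical
  rw [Expr.eval, H.reg1, Finset.sum_range, others, card_filter, ← sum_erase_add _ _ (mem_univ 0)]
  have h0 : (Expr.ind (.and (.var 16) e)).eval (Function.update ρ 16 ((0 : Fin n) : ℕ)) μ = 0 := by
    rw [Expr.eval_ind, if_neg]
    rw [Expr.holds_and]
    simp [Expr.Holds, Expr.eval]
  rw [h0, add_zero]
  refine sum_congr rfl fun i hi => ?_
  rw [Expr.eval_ind]
  have hpos : 0 < (i : ℕ) := Nat.pos_of_ne_zero fun h => (mem_erase.1 hi).1 (Fin.ext h)
  have : (Expr.and (.var 16) e).Holds (Function.update ρ 16 i) μ ↔ p i := by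
    rw [Expr.holds_and, he]
    simp [Expr.Holds, Expr.eval, hpos]
  simp only [this]

theorem Layout.holds_first_eq (H : Layout tb v t c ρ μ) {r : ℕ} (hr : r ≠ 16) {z : Fin m}
    (hz : ρ r = z) (i : Fin n) :
    (Expr.eq Expr.firstOption (.var r)).Holds (Function.update ρ 16 i) μ ↔ t i = z := by
  rw [Expr.holds_eq, Expr.firstOption]
  simp only [Expr.eval_var, Expr.eval_mem, Expr.eval_cell, Function.update_self, Function.update_of_ne hr, hz]
  rw [Function.update_of_ne (by decide), H.first, Fin.val_inj]

theorem Layout.holds_isOption (H : Layout tb v t c ρ μ) {r : ℕ} (hr : r ≠ 16) {z : Fin m}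
    (hz : ρ r = z) (i : Fin n) :
    (Expr.isOption r).Holds (Function.update ρ 16 i) μ ↔ t i = z ∨ c i = z := by
  rw [Expr.isOption, Expr.holds_or, H.holds_first_eq hr hz]
  rw [Expr.holds_eq, Expr.secondOption]
  simp only [Expr.eval_var, Expr.eval_mem, Expr.eval_cell, Function.update_self, Function.update_of_ne hr, hz]
  rw [Function.update_of_ne (by decide), H.second, Fin.val_inj]

theorem Layout.eval_sincereLoad (H : Layout tb v t c ρ μ) {r : ℕ} (hr : r ≠ 16) {z : Fin m}
    (hz : ρ r = z) : (Expr.sincereLoad r).eval ρ μ = load (others n) t z :=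
  H.eval_count fun i => H.holds_first_eq hr hz i

theorem Layout.eval_countOption (H : Layout tb v t c ρ μ) {r : ℕ} (hr : r ≠ 16) {z : Fin m}
    (hz : ρ r = z) : (Expr.countOption r).eval ρ μ = optionCount (others n) t c z :=
  H.eval_count fun i => H.holds_isOption hr hz i

theorem Layout.eval_countOption₂ (H : Layout tb v t c ρ μ) {r r' : ℕ} (hr : r ≠ 16)
    (hr' : r' ≠ 16) {z z' : Fin m} (hz : ρ r = z) (hz' : ρ r' = z') :
    (Expr.countOption₂ r r').eval ρ μ = optionCount₂ (others n) t c z z' :=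
  H.eval_count fun i => by
    rw [Expr.holds_or, H.holds_isOption hr hz, H.holds_isOption hr' hz']

/-- The registers hold the arguments of `Compatible`. -/
structure Arguments (ra rb : ℕ) (a b x y : Fin m) (X Y : ℕ) (ρ : ℕ → ℕ) : Prop where
  regA : ρ ra = a
  regB : ρ rb = b
  reg11 : ρ 11 = x
  reg12 : ρ 12 = y
  reg13 : ρ 13 = X
  reg14 : ρ 14 = Y

variable {ra rb : ℕ} {a b x y : Fin m} {X Y : ℕ}

theorem Arguments.update (A : Arguments ra rb a b x y X Y ρ) (ha : ra < 15) (hb : rb < 15)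
    {r : ℕ} (hr : 15 ≤ r) (i : ℕ) : Arguments ra rb a b x y X Y (Function.update ρ r i) := by
  obtain ⟨h1, h2, h3, h4, h5, h6⟩ := A
  constructor <;> rw [Function.update_of_ne (by omega)] <;> assumption

theorem Layout.holds_compatible (H : Layout tb v t c ρ μ) (A : Arguments ra rb a b x y X Y ρ)
    {r : ℕ} (hr : r ≠ 17) {z : Fin m} (hz : ρ r = z) {e : Expr} :
    (Expr.compatible ra rb r e).Holds ρ μ
      ↔ Compatible (rank tb) a b x y X Y z (e.eval ρ μ) := by
  classical
  have ez := H.eval_rank_tieBreaking hr hz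
  have ex := H.eval_rank_tieBreaking (r := 11) (by decide) A.reg11
  have ey := H.eval_rank_tieBreaking (r := 12) (by decide) A.reg12
  rw [Expr.compatible]
  simp only [Expr.holds_and, Expr.holds_imp, Expr.holds_eq, Expr.holds_not, Expr.holds_le,
    Expr.holds_beats, Expr.eval, Expr.eval_ind, ez, ex, ey, A.regA, A.regB, A.reg11, A.reg12,
    A.reg13, A.reg14, hz, Fin.val_inj, Compatible, ne_eq]

theorem Layout.eval_countViolations (H : Layout tb v t c ρ μ)
    (A : Arguments ra rb a b x y X Y ρ) (ha : ra < 15) (hb : rb < 15) :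
    (Expr.countViolations ra rb).eval ρ μ
      = violations (others n) t (Compatible (rank tb) a b x y X Y) := by
  classical
  rw [Expr.countViolations, violations, Expr.eval, H.reg2, Finset.sum_range]
  refine sum_congr rfl fun z _ => ?_
  have H' := H.update (r := 15) (by decide) z
  have A' := A.update ha hb (r := 15) le_rfl z
  have hz : Function.update ρ 15 (z : ℕ) 15 = z := Function.update_self _ _ _
  have hl := H'.eval_sincereLoad (by decide) hz
  simp only [Expr.eval_add, Expr.eval_sub, Expr.eval_num, Expr.eval_ite_holds,
    H'.holds_compatible A' (show 15 ≠ 17 by decide) hz, hl]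

/-- Reachability is not computed by the expression but read from the arrays `ka` and `kb`, whose
contents are assumptions here. -/
theorem Layout.holds_criterion (H : Layout tb v t c ρ μ)
    (A : Arguments ra rb a b x y X Y ρ) (ha : ra < 15) (hb : rb < 15) {ka kb : ℕ}
    (hka : ∀ z : Fin m, 0 < μ (ka * ρ 3 + z) ↔ z ∈ layer (others n) t c a (Fintype.card (Fin m)))
    (hkb : ∀ z : Fin m, 0 < μ (kb * ρ 3 + z) ↔ z ∈ layer (others n) t c b (Fintype.card (Fin m))) :
    (Expr.criterion ra rb ka kb).Holds ρ μ
      ↔ Criterion (others n) t c (rank tb) a b x y X Y := by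
  have hex : (Expr.ex 15 2 (.and (Expr.compatible ra rb 15 (.add (Expr.sincereLoad 15) (.num 1)))
      (.or (.and (.not (Expr.compatible ra rb ra (Expr.sincereLoad ra))) (.mem (.cell ka (.var 15))))
        (.and (.not (Expr.compatible ra rb rb (Expr.sincereLoad rb)))
          (.mem (.cell kb (.var 15))))))).Holds ρ μ ↔
      ∃ s, Compatible (rank tb) a b x y X Y s (load (others n) t s + 1) ∧
      (¬ Compatible (rank tb) a b x y X Y a (load (others n) t a) ∧
          s ∈ layer (others n) t c a (Fintype.card (Fin m)) ∨
       ¬ Compatible (rank tb) a b x y X Y b (load (others n) t b) ∧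
          s ∈ layer (others n) t c b (Fintype.card (Fin m))) := by
    have key : ∀ s : Fin m, (Expr.and
        (Expr.compatible ra rb 15 (.add (Expr.sincereLoad 15) (.num 1)))
        (.or (.and (.not (Expr.compatible ra rb ra (Expr.sincereLoad ra)))
          (.mem (.cell ka (.var 15))))
        (.and (.not (Expr.compatible ra rb rb (Expr.sincereLoad rb)))
          (.mem (.cell kb (.var 15)))))).Holds (Function.update ρ 15 s) μ ↔
        (Compatible (rank tb) a b x y X Y s (load (others n) t s + 1) ∧
        (¬ Compatible (rank tb) a b x y X Y a (load (others n) t a) ∧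
          s ∈ layer (others n) t c a (Fintype.card (Fin m)) ∨
        ¬ Compatible (rank tb) a b x y X Y b (load (others n) t b) ∧
          s ∈ layer (others n) t c b (Fintype.card (Fin m)))) := by
      intro s
      have H' := H.update (r := 15) (by decide) s
      have A' := A.update ha hb (r := 15) le_rfl s
      have hs : Function.update ρ 15 (s : ℕ) 15 = s := Function.update_self _ _ _
      have m1 : ∀ k, (Expr.mem (.cell k (.var 15))).Holds (Function.update ρ 15 (s : ℕ)) μ ↔
          0 < μ (k * ρ 3 + s) := by
        intro k
        rw [Expr.Holds, Expr.eval, Expr.eval_cell, Function.update_of_ne (by decide), Expr.eval, hs]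
      rw [Expr.holds_and, Expr.holds_or, Expr.holds_and, Expr.holds_and, Expr.holds_not,
        Expr.holds_not, H'.holds_compatible A' (by decide) hs,
        H'.holds_compatible A' (by omega) A'.regA, H'.holds_compatible A' (by omega) A'.regB,
        H'.eval_sincereLoad (by omega) A'.regA, H'.eval_sincereLoad (by omega) A'.regB, m1, m1,
        hka, hkb, Expr.eval, H'.eval_sincereLoad (by decide) hs, Expr.eval]
    rw [Expr.holds_ex, H.reg2]
    constructor
    · rintro ⟨s, hs, h⟩
      exact ⟨⟨s, hs⟩, (key ⟨s, hs⟩).1 h⟩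
    · rintro ⟨s, h⟩
      exact ⟨s, s.2, (key s).2 h⟩
  rw [Expr.criterion, Criterion]
  simp only [Expr.holds_and, Expr.holds_or, Expr.holds_le, Expr.holds_eq, hex,
    H.holds_compatible A (show 11 ≠ 17 by decide) A.reg11,
    H.holds_compatible A (show 12 ≠ 17 by decide) A.reg12,
    H.eval_countOption (show 11 ≠ 16 by decide) A.reg11,
    H.eval_countOption (show 12 ≠ 16 by decide) A.reg12,
    H.eval_countOption₂ (show 11 ≠ 16 by decide) (show 12 ≠ 16 by decide) A.reg11 A.reg12,
    H.eval_countViolations A ha hb, Expr.eval, A.reg13, A.reg14]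

end Layout

/-! ### The machine test for a worse outcome. -/

section Decision

variable {n m : ℕ} [NeZero n] [NeZero m] {tb : Vote m} {G : GSGame (n := n) (plurality tb)}
  {listing : Fin n → List (Vote m)}

theorem Layout.holds_worseSomewhere {ρ μ : ℕ → ℕ}
    (H : Layout tb (G.profile 0) (sincereTop G) (insincereTop G listing) ρ μ)
    {ra rb : ℕ} {a b : Fin m} (hra : ρ ra = a) (hrb : ρ rb = b) (ha : ra < 11) (hb : rb < 11)
    {ka kb : ℕ}
    (hka : ∀ z : Fin m, 0 < μ (ka * ρ 3 + z) ↔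
      z ∈ layer (others n) (sincereTop G) (insincereTop G listing) a (Fintype.card (Fin m)))
    (hkb : ∀ z : Fin m, 0 < μ (kb * ρ 3 + z) ↔
      z ∈ layer (others n) (sincereTop G) (insincereTop G listing) b (Fintype.card (Fin m))) :
    (Expr.worseSomewhere ra rb ka kb).Holds ρ μ ↔ WorseSomewhere G listing a b := by
  have key : ∀ (x y : Fin m) (X Y : ℕ), (Expr.criterion ra rb ka kb).Holds
      (Function.update (Function.update (Function.update (Function.update ρ 11 x) 12 y) 13 X) 14 Y)
      μ ↔ Criterion (others n) (sincereTop G) (insincereTop G listing) (rank tb) a b x y X Y := by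
    intro x y X Y
    refine Layout.holds_criterion ((((H.update (by decide) _).update (by decide) _).update
      (by decide) _).update (by decide) _) ⟨?_, ?_, ?_, ?_, ?_, ?_⟩ (by omega) (by omega) ?_ ?_
    · simp [show ra ≠ 11 by omega, show ra ≠ 12 by omega, show ra ≠ 13 by omega,
        show ra ≠ 14 by omega, hra]
    · simp [show rb ≠ 11 by omega, show rb ≠ 12 by omega, show rb ≠ 13 by omega,
        show rb ≠ 14 by omega, hrb]
    · simp
    · simp
    · simp
    · simp
    · simpa using hka
    · simpa using hkb
  have hrank : ∀ (x y : Fin m), (Expr.lt (Expr.rankAt Expr.sincereVote 12)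
      (Expr.rankAt Expr.sincereVote 11)).Holds (Function.update (Function.update ρ 11 x) 12 y) μ ↔
      rank (G.profile 0) y < rank (G.profile 0) x := by
    intro x y
    have H' := (H.update (r := 11) (by decide) x).update (r := 12) (by decide) y
    rw [Expr.holds_lt, H'.eval_rank_sincereVote (by decide) (z := y) (by simp),
      H'.eval_rank_sincereVote (by decide) (z := x) (by simp)]
  simp only [Expr.worseSomewhere, Expr.holds_ex, Expr.holds_and, WorseSomewhere]
  have e1 : ∀ i j, Function.update (Function.update ρ 11 i) 12 j 1 = n := by
    intro i j; simp [H.reg1]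
  have e2 : ∀ i j k, Function.update (Function.update (Function.update ρ 11 i) 12 j) 13 k 1 = n := by
    intro i j k; simp [H.reg1]
  have e3 : ∀ i, Function.update ρ 11 i 2 = m := by intro i; simp [H.reg2]
  simp only [e1, e2, e3, H.reg2]
  constructor
  · rintro ⟨x, hx, y, hy, hxy, X, hX, Y, hY, h⟩
    exact ⟨⟨x, hx⟩, ⟨y, hy⟩, (hrank ⟨x, hx⟩ ⟨y, hy⟩).1 hxy, X, hX, Y, hY,
      (key ⟨x, hx⟩ ⟨y, hy⟩ X Y).1 h⟩
  · rintro ⟨x, y, hxy, X, hX, Y, hY, h⟩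
    exact ⟨x, x.2, y, y.2, (hrank x y).2 hxy, X, hX, Y, hY, (key x y X Y).2 h⟩

end Decision

/-! ### Reading the input -/

section Encoding

variable {n m : ℕ} [NeZero n] [NeZero m]

theorem length_encodeVote (v : Vote m) : (encodeVote v).length = m := by simp [encodeVote]

/-- Read positions are described by the rest of the input that starts there; this advances a
position past a block. -/
theorem drop_add_of_drop_eq {w A R : List ℕ} {p k : ℕ} (h : w.drop p = A ++ R)
    (hk : A.length = k) : w.drop (p + k) = R := by
  rw [← List.drop_drop, h, ← hk, List.drop_left]

theorem getD_of_drop_eq {w A R : List ℕ} {p j : ℕ} (h : w.drop p = A ++ R) (hj : j < A.length) :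
    p + j < w.length ∧ w.getD (p + j) 0 = A[j] := by
  have hlen := congrArg List.length h
  rw [List.length_drop, List.length_append] at hlen
  have h1 : p + j < w.length := by omega
  refine ⟨h1, ?_⟩
  have h2 : (w.drop p)[j]? = some A[j] := by
    rw [h, List.getElem?_append_left hj, List.getElem?_eq_getElem hj]
  rw [List.getElem?_drop] at h2
  rw [List.getD_eq_getElem?_getD, h2, Option.getD_some]

theorem getD_of_drop_eq_encodeVote {w R : List ℕ} {p : ℕ} {v : Vote m}
    (h : w.drop p = encodeVote v ++ R) (q : Fin m) :
    p + q < w.length ∧ w.getD (p + q) 0 = v q := by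
  have hq : (q : ℕ) < (encodeVote v).length := by rw [length_encodeVote]; exact q.2
  obtain ⟨h1, h2⟩ := getD_of_drop_eq h hq
  refine ⟨h1, h2.trans ?_⟩
  simp [encodeVote]

theorem getD_top {w R : List ℕ} {p : ℕ} {v : Vote m} (h : w.drop p = encodeVote v ++ R) :
    p < w.length ∧ w.getD p 0 = (v 0 : Fin m) := by
  simpa using getD_of_drop_eq_encodeVote h 0

theorem drop_finRange {i : ℕ} (hi : i < n) :
    (List.finRange n).drop i = ⟨i, hi⟩ :: (List.finRange n).drop (i + 1) := by
  rw [List.drop_eq_getElem_cons (by simpa using hi)]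
  simp

/-- The sincere votes of all voters from voter `i` on. -/
def profileSuffix (prof : Fin n → Vote m) (i : ℕ) : List ℕ :=
  ((List.finRange n).drop i).flatMap fun i => encodeVote (prof i)

/-- The strategies of all voters from voter `i` on. -/
def listingSuffix (listing : Fin n → List (Vote m)) (i : ℕ) : List ℕ :=
  ((List.finRange n).drop i).flatMap fun i => encodeVotes (listing i)

theorem profileSuffix_eq (prof : Fin n → Vote m) {i : ℕ} (hi : i < n) :
    profileSuffix prof i = encodeVote (prof ⟨i, hi⟩) ++ profileSuffix prof (i + 1) := by
  rw [profileSuffix, drop_finRange hi, List.flatMap_cons, profileSuffix]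

theorem listingSuffix_eq (listing : Fin n → List (Vote m)) {i : ℕ} (hi : i < n) :
    listingSuffix listing i = [(listing ⟨i, hi⟩).length] ++
      ((listing ⟨i, hi⟩).flatMap encodeVote ++ listingSuffix listing (i + 1)) := by
  rw [listingSuffix, drop_finRange hi, List.flatMap_cons, listingSuffix, encodeVotes]
  simp

theorem listingSuffix_length (listing : Fin n → List (Vote m)) : listingSuffix listing n = [] := by
  rw [listingSuffix, List.drop_eq_nil_of_le (by simp), List.flatMap_nil]

theorem length_profileSuffix (prof : Fin n → Vote m) : (profileSuffix prof 0).length = n * m := by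
  simp [profileSuffix, List.length_flatMap, length_encodeVote]

/-- Each vote occupies `m ≥ 1` cells, so the input length bounds the number of strategies of a
voter. -/
theorem length_le_length_flatMap (L : List (Vote m)) :
    L.length ≤ (L.flatMap encodeVote).length := by
  simp only [List.length_flatMap, length_encodeVote, List.map_const', List.sum_replicate,
    smul_eq_mul]
  exact Nat.le_mul_of_pos_right _ (NeZero.pos m)

/-- An instance as a list of numbers, with the parts in the same order as in
`PluralityInstance.encode`. -/
def encoding (tb : Vote m) (prof : Fin n → Vote m) (listing : Fin n → List (Vote m))
    (u v : Vote m) : List ℕ :=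
  [n, m] ++ (encodeVote tb ++ (profileSuffix prof 0 ++
    (listingSuffix listing 0 ++ (encodeVote u ++ encodeVote v))))

end Encoding

/-! ### The algorithm as a program with bounded loops. -/

namespace Cmd

/-- Read the strategy number `reg 7` of the voter `reg 6`, who has `reg 8` strategies. -/
def readStrategy : Cmd :=
  seq (store (.cell 2 (.var 6))
      (.ite (.and (.lt (.var 7) (.var 8)) (.not (.eq (.mem (.var 5)) (.mem (.var 4)))))
        (.mem (.var 5)) (.mem (.cell 2 (.var 6)))))
    (assign 5 (.add (.var 5) (.ite (.lt (.var 7) (.var 8)) (.var 2) (.num 0))))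

/-- Read the sincere vote of the voter `reg 6` at `reg 4`, and her strategies at `reg 5`. -/
def readVoter : Cmd :=
  seq (store (.cell 1 (.var 6)) (.mem (.var 4))) <|
  seq (store (.cell 2 (.var 6)) (.mem (.var 4))) <|
  seq (assign 8 (.mem (.var 5))) <|
  seq (assign 5 (.add (.var 5) (.num 1))) <|
  seq (loop 7 3 readStrategy) (assign 4 (.add (.var 4) (.var 2)))

/-- Read the options of all voters, and the top candidates of the two votes that are compared. -/
def readInput : Cmd :=
  seq (assign 4 (.add (.num 2) (.var 2))) <|
  seq (assign 5 (.add (.var 4) (.sum 16 1 (.var 2)))) <|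
  seq (loop 6 1 readVoter) <|
  seq (assign 9 (.mem (.var 5))) (assign 10 (.mem (.add (.var 5) (.var 2))))

/-- Compute in array `k` the candidates that are reached from the candidate in register `r`. -/
def reach (k r : ℕ) : Cmd :=
  seq (store (.cell k (.var r)) (.num 1))
    (loop 6 2 (loop 16 1 (store (.cell k Expr.secondOption)
      (.ite (.mem (.cell k Expr.firstOption)) (.num 1) (.mem (.cell k Expr.secondOption))))))

/-- The decision algorithm. -/
def main : Cmd :=
  seq readInput <| seq (reach 3 9) <| seq (reach 4 10) <|
    assign 0 (.ind (.and (.not (Expr.worseSomewhere 9 10 3 4)) (Expr.worseSomewhere 10 9 4 3)))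

end Cmd

/-! ### Correctness of the reading phase. -/

section Reading

variable {n m : ℕ} [NeZero n] [NeZero m]

/-- The registers `1`, `2` and `3` hold the number of voters, the number of candidates and the
length of the input. -/
structure Sizes (n m : ℕ) (w : List ℕ) (ρ : ℕ → ℕ) : Prop where
  reg1 : ρ 1 = n
  reg2 : ρ 2 = m
  reg3 : ρ 3 = w.length

theorem Sizes.update {w : List ℕ} {ρ : ℕ → ℕ} (H : Sizes n m w ρ) {r : ℕ} (hr : 4 ≤ r) (a : ℕ) :
    Sizes n m w (Function.update ρ r a) := by
  obtain ⟨h1, h2, h3⟩ := H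
  constructor <;> rw [Function.update_of_ne (by omega)] <;> assumption

/-- The state before strategy number `k` of the list `L` of strategies of voter `i` is read. -/
structure ReadingStrategies (w : List ℕ) (t : Fin m) (L : List (Vote m)) (R : List ℕ) (p i : ℕ)
    (μ : ℕ → ℕ) (k : ℕ) (s : Store) : Prop where
  sizes : Sizes n m w s.reg
  reg4 : s.reg 4 = p
  reg6 : s.reg 6 = i
  reg7 : s.reg 7 = k
  reg8 : s.reg 8 = L.length
  reg5 : w.drop (s.reg 5) = (L.drop k).flatMap encodeVote ++ R
  cell : s.mem (2 * w.length + i) = lastOtherTop t (L.take k)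
  mem : ∀ x, x ≠ 2 * w.length + i → s.mem x = μ x

/-- The loop runs `w.length` times, because only protected registers may bound it. Once `k` passes
the end of `L`, neither the pointer nor the cell changes. -/
theorem ReadingStrategies.step {w : List ℕ} {t : Fin m} {L : List (Vote m)} {R : List ℕ} {p i : ℕ}
    {μ : ℕ → ℕ} {k : ℕ} {s : Store} (hμ : ∀ x < w.length, μ x = w.getD x 0)
    (hp : p < w.length) (ht : w.getD p 0 = t)
    (H : ReadingStrategies (n := n) w t L R p i μ k s) :
    ReadingStrategies (n := n) w t L R p i μ (k + 1) { Cmd.readStrategy.run s with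
      reg := Function.update (Cmd.readStrategy.run s).reg 7
        ((Cmd.readStrategy.run s).reg 7 + 1) } := by
  classical
  obtain ⟨hs, h4, h6, h7, h8, h5, hc, hm⟩ := H
  have hmem : ∀ x < w.length, s.mem x = w.getD x 0 := fun x hx =>
    (hm x (by omega)).trans (hμ x hx)
  have hrun : Cmd.readStrategy.run s =
      { mem := Function.update s.mem (2 * w.length + i)
          (if k < L.length ∧ ¬ s.mem (s.reg 5) = t then s.mem (s.reg 5)
            else lastOtherTop t (L.take k))
        reg := Function.update s.reg 5 (s.reg 5 + if k < L.length then m else 0) } := by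
    simp only [Cmd.readStrategy, Cmd.run, Expr.eval_ite_holds, Expr.holds_and, Expr.holds_lt,
      Expr.holds_not, Expr.holds_eq, Expr.eval_cell, Expr.eval_mem, Expr.eval_var, Expr.eval_add,
      Expr.eval_num, hs.reg2, hs.reg3, h4, h6, h7, h8, hc, hmem p hp, ht]
  rw [hrun]
  refine ⟨(hs.update (by decide) _).update (by decide) _, by simpa using h4, by simpa using h6,
    by simp [h7], by simpa using h8, ?_, ?_, ?_⟩
  · by_cases hk : k < L.length
    · rw [List.drop_eq_getElem_cons hk, List.flatMap_cons, List.append_assoc] at h5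
      simpa [hk] using drop_add_of_drop_eq h5 (length_encodeVote _)
    · rw [List.drop_eq_nil_of_le (show L.length ≤ k by omega)] at h5
      simpa [hk, List.drop_eq_nil_of_le (show L.length ≤ k + 1 by omega)] using h5
  · by_cases hk : k < L.length
    · rw [List.drop_eq_getElem_cons hk, List.flatMap_cons, List.append_assoc] at h5
      obtain ⟨h51, h52⟩ := getD_top h5
      have e : s.mem (s.reg 5) = (L[k] 0 : Fin m) := (hmem _ h51).trans h52
      simp only [Function.update_self]
      simp only [List.take_succ_eq_append_getElem hk, lastOtherTop_concat, e, Fin.val_inj]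
      by_cases h : L[k] 0 = t <;> simp [h, hk]
    · simp [hk, List.take_of_length_le (show L.length ≤ k + 1 by omega),
        List.take_of_length_le (show L.length ≤ k by omega)]
  · intro x hx
    simp only [Function.update_of_ne hx]
    exact hm x hx

/-- The state before the votes of voter `i` are read. -/
structure ReadingVoters (w : List ℕ) (prof : Fin n → Vote m) (listing : Fin n → List (Vote m))
    (R R' : List ℕ) (i : ℕ) (s : Store) : Prop where
  sizes : Sizes n m w s.reg
  reg6 : s.reg 6 = i
  reg4 : w.drop (s.reg 4) = profileSuffix prof i ++ R
  reg5 : w.drop (s.reg 5) = listingSuffix listing i ++ R'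
  input : ∀ x < w.length, s.mem x = w.getD x 0
  first : ∀ j : Fin n, (j : ℕ) < i → s.mem (1 * w.length + j) = (prof j 0 : Fin m)
  second : ∀ j : Fin n, (j : ℕ) < i →
    s.mem (2 * w.length + j) = lastOtherTop (prof j 0) (listing j)
  rest : ∀ x ≥ 3 * w.length, s.mem x = 0

theorem ReadingVoters.step {w : List ℕ} {prof : Fin n → Vote m}
    {listing : Fin n → List (Vote m)} {R R' : List ℕ} {i : ℕ} {s : Store} (hn : n ≤ w.length)
    (hi : i < n) (H : ReadingVoters w prof listing R R' i s) :
    ReadingVoters w prof listing R R' (i + 1) { Cmd.readVoter.run s with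
      reg := Function.update (Cmd.readVoter.run s).reg 6 ((Cmd.readVoter.run s).reg 6 + 1) } := by
  obtain ⟨hs, h6, h4, h5, hinput, hfirst, hsecond, hrest⟩ := H
  rw [profileSuffix_eq prof hi, List.append_assoc] at h4
  obtain ⟨h41, h42⟩ := getD_top h4
  rw [listingSuffix_eq listing hi, List.append_assoc, List.append_assoc] at h5
  obtain ⟨h51, h52⟩ := getD_of_drop_eq (j := 0) h5 (by simp)
  have h5' := drop_add_of_drop_eq h5 (k := 1) rfl
  set t := prof ⟨i, hi⟩ 0 with htdef
  set L := listing ⟨i, hi⟩ with hL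
  simp only [add_zero, List.getElem_cons_zero] at h51 h52
  -- This makes the `w.length` iterations long enough to read every strategy.
  have hLlen : L.length ≤ w.length := by
    have h := congrArg List.length h5'
    rw [List.length_drop, List.length_append] at h
    have := length_le_length_flatMap L
    omega
  set μ : ℕ → ℕ := Function.update (Function.update s.mem (1 * w.length + i) t)
    (2 * w.length + i) t with hμdef
  have hμinput : ∀ x < w.length, μ x = w.getD x 0 := by
    intro x hx
    rw [hμdef, Function.update_of_ne (by omega), Function.update_of_ne (by omega)]
    exact hinput x hx
  set s1 : Store := ⟨Function.update (Function.update s.reg 8 L.length) 5 (s.reg 5 + 1), μ⟩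
    with hs1
  have hrun : Cmd.readVoter.run s = (Cmd.assign 4 (.add (.var 4) (.var 2))).run
      ((Cmd.loop 7 3 Cmd.readStrategy).run s1) := by
    have e4 : Function.update s.mem (1 * w.length + i) (t : ℕ) (s.reg 4) = t := by
      rw [Function.update_of_ne (by omega), hinput _ h41, h42]
    have e5 : μ (s.reg 5) = L.length := (hμinput _ h51).trans h52
    simp only [Cmd.readVoter, Cmd.run.eq_3]
    congr 2
    simp only [Cmd.run, Expr.eval_cell, Expr.eval_mem, Expr.eval_var, Expr.eval_add,
      Expr.eval_num, hs.reg3, h6, hinput _ h41, h42, e4]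
    rw [← hμdef, e5]
    simp [hs1]
  have hloop : ReadingStrategies (n := n) w t L (listingSuffix listing (i + 1) ++ R') (s.reg 4) i μ
      (s1.reg 3) ((Cmd.loop 7 3 Cmd.readStrategy).run s1) := by
    refine Cmd.run_loop_induction (ReadingStrategies (n := n) w t L
      (listingSuffix listing (i + 1) ++ R') (s.reg 4) i μ) ?_ fun k s' _ h =>
        h.step hμinput h41 h42
    refine ⟨((hs.update (by decide) _).update (by decide) _).update (by decide) _, ?_, ?_, ?_, ?_,
      ?_, ?_, ?_⟩
    · simp [hs1]
    · simp [hs1, h6]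
    · simp
    · simp [hs1]
    · simpa [hs1] using h5'
    · simp [hs1, hμdef, lastOtherTop]
    · intro x _
      rfl
  have hs13 : s1.reg 3 = w.length := by simp [hs1, hs.reg3]
  rw [hs13] at hloop
  set s2 := (Cmd.loop 7 3 Cmd.readStrategy).run s1
  obtain ⟨ks, k4, k6, k7, k8, k5, kc, km⟩ := hloop
  rw [List.drop_eq_nil_of_le hLlen] at k5
  rw [List.take_of_length_le hLlen] at kc
  rw [hrun]
  simp only [Cmd.run, Expr.eval_add, Expr.eval_var, ks.reg2, k4]
  refine ⟨(ks.update (by decide) _).update (by decide) _, ?_, ?_, ?_, ?_, ?_, ?_, ?_⟩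
  · simp [k6]
  · simpa using drop_add_of_drop_eq h4 (length_encodeVote _)
  · simpa using k5
  · intro x hx
    exact (km x (by omega)).trans (hμinput x hx)
  · intro j hj
    simp only
    rw [km _ (by have := j.2; omega), hμdef, Function.update_of_ne (by have := j.2; omega)]
    by_cases e : (j : ℕ) = i
    · obtain rfl : j = ⟨i, hi⟩ := Fin.ext e
      simp [htdef]
    · rw [Function.update_of_ne (by omega)]
      exact hfirst j (by omega)
  · intro j hj
    by_cases e : (j : ℕ) = i
    · obtain rfl : j = ⟨i, hi⟩ := Fin.ext e
      exact kc
    · simp only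
      rw [km _ (by omega), hμdef, Function.update_of_ne (by omega),
        Function.update_of_ne (by have := j.2; omega)]
      exact hsecond j (by omega)
  · intro x hx
    simp only
    rw [km _ (by omega), hμdef, Function.update_of_ne (by omega),
      Function.update_of_ne (by omega)]
    exact hrest x hx

/-- The state after the input is read. -/
structure InputRead (w : List ℕ) (tb : Vote m) (prof : Fin n → Vote m)
    (listing : Fin n → List (Vote m)) (u v : Vote m) (s : Store) : Prop where
  sizes : Sizes n m w s.reg
  reg9 : s.reg 9 = (u 0 : Fin m)
  reg10 : s.reg 10 = (v 0 : Fin m)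
  tieBreaking : ∀ q : Fin m, s.mem (2 + q) = tb q
  sincereVote : ∀ q : Fin m, s.mem (2 + m + q) = prof 0 q
  first : ∀ j : Fin n, s.mem (1 * w.length + j) = (prof j 0 : Fin m)
  second : ∀ j : Fin n, s.mem (2 * w.length + j) = lastOtherTop (prof j 0) (listing j)
  rest : ∀ x ≥ 3 * w.length, s.mem x = 0

theorem le_length_encoding (tb : Vote m) (prof : Fin n → Vote m)
    (listing : Fin n → List (Vote m)) (u v : Vote m) :
    n ≤ (encoding tb prof listing u v).length ∧
      2 + m + m ≤ (encoding tb prof listing u v).length := by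
  have h : n ≤ n * m := Nat.le_mul_of_pos_right _ (NeZero.pos m)
  have h' : m ≤ n * m := Nat.le_mul_of_pos_left _ (NeZero.pos n)
  simp only [encoding, List.length_append, length_profileSuffix, length_encodeVote,
    List.length_cons]
  omega

theorem inputRead (tb : Vote m) (prof : Fin n → Vote m) (listing : Fin n → List (Vote m))
    (u v : Vote m) {s : Store} (hs : Sizes n m (encoding tb prof listing u v) s.reg)
    (hmem : ∀ x, s.mem x = (encoding tb prof listing u v).getD x 0) :
    InputRead (encoding tb prof listing u v) tb prof listing u v (Cmd.readInput.run s) := by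
  set w := encoding tb prof listing u v with hw
  have hn : n ≤ w.length := (le_length_encoding tb prof listing u v).1
  have hzero : ∀ x ≥ w.length, s.mem x = 0 := fun x hx => by
    rw [hmem, List.getD_eq_default _ _ hx]
  have hd2 : w.drop 2 = encodeVote tb ++ (profileSuffix prof 0 ++
    (listingSuffix listing 0 ++ (encodeVote u ++ encodeVote v))) := rfl
  have hd3 := drop_add_of_drop_eq hd2 (length_encodeVote _)
  have hd4 := drop_add_of_drop_eq hd3 (length_profileSuffix _)
  set s1 : Store :=
    ⟨Function.update (Function.update s.reg 4 (2 + m)) 5 (2 + m + n * m), s.mem⟩ with hs1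
  have hrun : Cmd.readInput.run s =
      (Cmd.seq (Cmd.assign 9 (.mem (.var 5))) (Cmd.assign 10 (.mem (.add (.var 5) (.var 2))))).run
      ((Cmd.loop 6 1 Cmd.readVoter).run s1) := by
    rw [Cmd.readInput, Cmd.run.eq_3, Cmd.run.eq_3, Cmd.run.eq_3]
    -- The machine has no multiplication; `n * m` is a sum of `n` copies of `m`.
    congr 2
    have hsum : ∑ _x ∈ range n, m = n * m := by simp
    simp [Cmd.run, Expr.eval, hs.reg1, hs.reg2, hsum, hs1]
  have hloop : ReadingVoters w prof listing (listingSuffix listing 0 ++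
      (encodeVote u ++ encodeVote v)) (encodeVote u ++ encodeVote v) (s1.reg 1)
      ((Cmd.loop 6 1 Cmd.readVoter).run s1) := by
    have hs11 : s1.reg 1 = n := by simp [hs1, hs.reg1]
    refine Cmd.run_loop_induction (ReadingVoters w prof listing (listingSuffix listing 0 ++
      (encodeVote u ++ encodeVote v)) (encodeVote u ++ encodeVote v)) ?_ fun i s' hi h =>
        h.step hn (hs11 ▸ hi)
    refine ⟨((hs.update (by decide) _).update (by decide) _).update (by decide) _, ?_, ?_, ?_, ?_,
      ?_, ?_, ?_⟩
    · simp
    · simpa [hs1] using hd3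
    · simpa [hs1] using hd4
    · exact fun x _ => hmem x
    · exact fun j hj => absurd hj (Nat.not_lt_zero _)
    · exact fun j hj => absurd hj (Nat.not_lt_zero _)
    · exact fun x hx => hzero x (by omega)
  rw [show s1.reg 1 = n by simp [hs1, hs.reg1]] at hloop
  set s2 := (Cmd.loop 6 1 Cmd.readVoter).run s1
  obtain ⟨ks, k6, k4, k5, kinput, kfirst, ksecond, krest⟩ := hloop
  rw [listingSuffix_length, List.nil_append] at k5
  obtain ⟨u1, u2⟩ := getD_top k5
  have k5' := drop_add_of_drop_eq k5 (length_encodeVote _)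
  rw [← List.append_nil (encodeVote v)] at k5'
  obtain ⟨v1, v2⟩ := getD_top k5'
  rw [hrun]
  simp only [Cmd.run, Expr.eval_add, Expr.eval_var, Expr.eval_mem]
  refine ⟨(ks.update (by decide) _).update (by decide) _, ?_, ?_, ?_, ?_, fun j => kfirst j j.2,
    fun j => ksecond j j.2, krest⟩
  · simp only [Function.update_self, ne_eq, Nat.reduceEqDiff, not_false_eq_true,
      Function.update_of_ne]
    rw [kinput _ u1, u2]
  · simp only [Function.update_self, ne_eq, Nat.reduceEqDiff, not_false_eq_true,
      Function.update_of_ne, ks.reg2]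
    rw [kinput _ v1, v2]
  · intro q
    obtain ⟨h1, h2⟩ := getD_of_drop_eq_encodeVote hd2 q
    exact (kinput _ h1).trans h2
  · intro q
    rw [profileSuffix_eq prof (NeZero.pos n), List.append_assoc] at hd3
    obtain ⟨h1, h2⟩ := getD_of_drop_eq_encodeVote hd3 q
    exact (kinput _ h1).trans h2

end Reading

/-! ### Reachable candidates -/

section Reaching

variable {n m : ℕ} [NeZero n] [NeZero m]

/-- A state `s` of the computation of the candidates that are reached from `v`, in the array at
address `B`, when the moves in `k` rounds and those of the first `i` voters in the next round have
been made; `s₀` is the initial state. -/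
structure Reaching (t c : Fin n → Fin m) (v : Fin m) (B : ℕ) (s₀ : Store) (k i : ℕ) (s : Store) :
    Prop where
  reg : ∀ r, r ≠ 6 → r ≠ 16 → s.reg r = s₀.reg r
  mem : ∀ x, x < B ∨ B + m ≤ x → s.mem x = s₀.mem x
  sound : ∀ z : Fin m, 0 < s.mem (B + z) → ∃ j, z ∈ layer (others n) t c v j
  complete : ∀ z ∈ layer (others n) t c v k, 0 < s.mem (B + z)
  partially : ∀ j : Fin n, (j : ℕ) < i → t j ∈ layer (others n) t c v k → 0 < s.mem (B + c j)

theorem Reaching.congr {t c : Fin n → Fin m} {v : Fin m} {B : ℕ} {s₀ : Store} {k i : ℕ} {s : Store}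
    (H : Reaching t c v B s₀ k i s) {r : ℕ} (hr : r = 6 ∨ r = 16) (a : ℕ) :
    Reaching t c v B s₀ k i { s with reg := Function.update s.reg r a } := by
  obtain ⟨h1, h2, h3, h4, h5⟩ := H
  refine ⟨fun r' h6 h16 => ?_, h2, h3, h4, h5⟩
  simp only
  rw [Function.update_of_ne (by omega)]
  exact h1 r' h6 h16

/-- A full pass over the voters contains all moves out of layer `k`, hence covers layer `k + 1`. -/
theorem Reaching.next {t c : Fin n → Fin m} {v : Fin m} {B : ℕ} {s₀ : Store} {k : ℕ} {s : Store}
    (H : Reaching t c v B s₀ k n s) : Reaching t c v B s₀ (k + 1) 0 s := by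
  obtain ⟨h1, h2, h3, h4, h5⟩ := H
  refine ⟨h1, h2, h3, fun z hz => ?_, fun j hj => absurd hj (Nat.not_lt_zero _)⟩
  rw [layer, mem_union, mem_image] at hz
  rcases hz with hz | ⟨j, hj, rfl⟩
  · exact h4 z hz
  · exact h5 j j.2 (mem_filter.1 hj).2

/-- Marks made in a round are used at once, so after `k` rounds the array may contain more than
layer `k`. It contains at least this layer and only reachable candidates, and after `m` rounds these
two bounds agree. -/
theorem reach_run {w : List ℕ} {t c : Fin n → Fin m} {v : Fin m} {k r : ℕ} {s : Store}
    (hs : Sizes n m w s.reg) (hr : s.reg r = v) (hk : 3 ≤ k) (hn : n ≤ w.length)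
    (hfirst : ∀ j : Fin n, s.mem (1 * w.length + j) = t j)
    (hsecond : ∀ j : Fin n, s.mem (2 * w.length + j) = c j)
    (hzero : ∀ z : Fin m, s.mem (k * w.length + z) = 0) (h0 : c 0 = t 0) :
    (∀ r', r' ≠ 6 → r' ≠ 16 → ((Cmd.reach k r).run s).reg r' = s.reg r') ∧
    (∀ x, x < k * w.length ∨ k * w.length + m ≤ x → ((Cmd.reach k r).run s).mem x = s.mem x) ∧
    ∀ z : Fin m, 0 < ((Cmd.reach k r).run s).mem (k * w.length + z) ↔
      z ∈ layer (others n) t c v (Fintype.card (Fin m)) := by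
  classical
  set B := k * w.length with hBdef
  have hB : 3 * w.length ≤ B := Nat.mul_le_mul_right _ hk
  set body : Cmd := Cmd.store (.cell k Expr.secondOption)
    (.ite (.mem (.cell k Expr.firstOption)) (.num 1) (.mem (.cell k Expr.secondOption))) with hbody
  set s1 : Store := ⟨s.reg, Function.update s.mem (B + v) 1⟩ with hs1
  have hrun : (Cmd.reach k r).run s = (Cmd.loop 6 2 (Cmd.loop 16 1 body)).run s1 := by
    rw [Cmd.reach, Cmd.run.eq_3]
    congr 1
    simp only [Cmd.run, Expr.eval_cell, Expr.eval_var, Expr.eval_num, hs.reg3, hr]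
    rfl
  have hstep : ∀ (l i : ℕ) (s' : Store), i < n → s'.reg 16 = i → Reaching t c v B s l i s' →
      Reaching t c v B s l (i + 1) (body.run s') := by
    intro l i s' hi h16 H
    obtain ⟨h1, h2, h3, h4, h5⟩ := H
    set j : Fin n := ⟨i, hi⟩ with hj
    have ht : s'.mem (1 * w.length + i) = t j := by
      rw [h2 _ (by omega)]
      exact hfirst j
    have hc : s'.mem (2 * w.length + i) = c j := by
      rw [h2 _ (by omega)]
      exact hsecond j
    have hreg3 : s'.reg 3 = w.length := (h1 3 (by decide) (by decide)).trans hs.reg3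
    have hb : body.run s' = ⟨s'.reg, Function.update s'.mem (B + c j)
        (if 0 < s'.mem (B + t j) then 1 else s'.mem (B + c j))⟩ := by
      simp only [hbody, Cmd.run, Expr.eval_cell, Expr.eval_var, Expr.eval_num, Expr.eval_mem,
        Expr.eval_ite_holds, Expr.firstOption, Expr.secondOption, Expr.Holds, hreg3, h16, ht, hc]
      rfl
    rw [hb]
    have hpos : ∀ z : Fin m, 0 < s'.mem (B + z) → 0 < Function.update s'.mem (B + c j)
        (if 0 < s'.mem (B + t j) then 1 else s'.mem (B + c j)) (B + z) := by
      intro z hz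
      by_cases e : c j = z
      · subst e
        rw [Function.update_self]
        split_ifs <;> omega
      · rwa [Function.update_of_ne fun h => e (Fin.ext (by omega))]
    refine ⟨h1, fun x hx => ?_, fun z hz => ?_, fun z hz => hpos z (h4 z hz), fun j' hj' hl => ?_⟩
    · have := (c j).2
      simp only
      rw [Function.update_of_ne (by omega)]
      exact h2 x hx
    · by_cases e : c j = z
      · subst e
        simp only [Function.update_self] at hz
        by_cases h : 0 < s'.mem (B + t j)
        · obtain ⟨d, hd⟩ := h3 _ h
          -- The program also treats voter `0`, who is not in `others n`; since `c 0 = t 0`, this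
          -- marks nothing new.
          by_cases hj0 : j = 0
          · rw [hj0, h0, ← hj0]
            exact ⟨d, hd⟩
          · exact ⟨d + 1, mem_layer_succ_of_move (mem_others.2 hj0) hd⟩
        · rw [if_neg h] at hz
          exact h3 _ hz
      · simp only at hz
        rw [Function.update_of_ne fun h => e (Fin.ext (by omega))] at hz
        exact h3 z hz
    · by_cases e : j' = j
      · subst e
        simp only [Function.update_self]
        rw [if_pos (h4 _ hl)]
        exact one_pos
      · exact hpos _ (h5 j' (lt_of_le_of_ne (Nat.lt_succ_iff.1 hj') fun h => e (Fin.ext h)) hl)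
  have hround : ∀ (l : ℕ) (s' : Store), Reaching t c v B s l 0 s' →
      Reaching t c v B s (l + 1) 0 ((Cmd.loop 16 1 body).run s') := by
    intro l s' H
    have hn' : s'.reg 1 = n := (H.reg 1 (by decide) (by decide)).trans hs.reg1
    have := Cmd.run_loop_induction (v := 16) (b := 1) (p := body) (s := s')
      (fun i s'' => s''.reg 16 = i ∧ Reaching t c v B s l i s'')
      ⟨by simp, H.congr (Or.inr rfl) 0⟩ (fun i s'' hi h =>
        ⟨by simp [hbody, Cmd.run, h.1],
          (hstep l i s'' (hn' ▸ hi) h.1 h.2).congr (Or.inr rfl) _⟩)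
    rw [hn'] at this
    exact this.2.next
  have hinit : Reaching t c v B s 0 0 s1 := by
    refine ⟨fun _ _ _ => rfl, fun x hx => ?_, fun z hz => ?_, fun z hz => ?_, fun j hj =>
      absurd hj (Nat.not_lt_zero _)⟩
    · exact Function.update_of_ne (by have := v.2; omega) _ _
    · by_cases e : z = v
      · exact ⟨0, by simp [layer, e]⟩
      · simp only [hs1] at hz
        rw [Function.update_of_ne fun h => e (Fin.ext (by omega)), hzero] at hz
        exact absurd hz (lt_irrefl _)
    · obtain rfl : z = v := by simpa [layer] using hz
      simp [hs1]
  have hfinal : Reaching t c v B s m 0 ((Cmd.loop 6 2 (Cmd.loop 16 1 body)).run s1) := by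
    have := Cmd.run_loop_induction (v := 6) (b := 2) (p := Cmd.loop 16 1 body) (s := s1)
      (fun l s' => Reaching t c v B s l 0 s') (hinit.congr (Or.inl rfl) 0)
      (fun l s' _ h => (hround l s' h).congr (Or.inl rfl) _)
    rwa [show s1.reg 2 = m from hs.reg2] at this
  rw [hrun]
  refine ⟨hfinal.reg, hfinal.mem, fun z => ⟨fun hz => ?_, fun hz => ?_⟩⟩
  · obtain ⟨j, hj⟩ := hfinal.sound z hz
    exact mem_layer_card hj
  · rw [Fintype.card_fin] at hz
    exact hfinal.complete z hz

end Reaching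

/-! ### The algorithm -/

section Algorithm

variable {n m : ℕ} [NeZero n] [NeZero m] {tb : Vote m} {G : GSGame (n := n) (plurality tb)}
  {listing : Fin n → List (Vote m)}

theorem Cmd.run_assign_reg (r : ℕ) (e : Expr) (s : Store) :
    ((Cmd.assign r e).run s).reg r = e.eval s.reg s.mem := by
  simp [Cmd.run]

theorem Cmd.main_run_reg_zero (s : Store) : (Cmd.main.run s).reg 0 =
    (Expr.ind (.and (.not (Expr.worseSomewhere 9 10 3 4)) (Expr.worseSomewhere 10 9 4 3))).eval
      ((Cmd.reach 4 10).run ((Cmd.reach 3 9).run (Cmd.readInput.run s))).reg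
      ((Cmd.reach 4 10).run ((Cmd.reach 3 9).run (Cmd.readInput.run s))).mem := by
  rw [Cmd.main, Cmd.run.eq_3, Cmd.run.eq_3, Cmd.run.eq_3, Cmd.run_assign_reg]

-- The arrays `3` and `4` do not overlap and lie above the input and the options, because `n` and
-- `m` are at most `w.length`; each phase leaves the results of the earlier ones intact.
open Classical in
theorem main_run (hplayer : ∀ i, (listing i.1).toFinset = G.strat i)
    (hnon : ∀ i : Fin n, ¬ (i ≠ 0 ∧ IsGSManipulator (plurality tb) G.profile i) → listing i = [])
    (u v : Vote m) {s : Store} (hs : Sizes n m (encoding tb G.profile listing u v) s.reg)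
    (hmem : ∀ x, s.mem x = (encoding tb G.profile listing u v).getD x 0) :
    (Cmd.main.run s).reg 0 = if G.Dominates u v then 1 else 0 := by
  obtain ⟨hn, hin⟩ := le_length_encoding tb G.profile listing u v
  have H1 := inputRead tb G.profile listing u v hs hmem
  set w := encoding tb G.profile listing u v
  set s1 := Cmd.readInput.run s
  -- Voter `0` has no listed strategies, so her two options coincide.
  have h0 : insincereTop G listing 0 = sincereTop G 0 := by
    rw [insincereTop, hnon 0 (by simp)]
    rfl
  obtain ⟨r2, m2, l2⟩ := reach_run (k := 3) (r := 9) (t := sincereTop G)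
    (c := insincereTop G listing) H1.sizes H1.reg9 le_rfl hn H1.first H1.second
    (fun z => H1.rest _ (by omega)) h0
  set s2 := (Cmd.reach 3 9).run s1
  have z2 : Sizes n m w s2.reg := by
    obtain ⟨e1, e2, e3⟩ := H1.sizes
    constructor <;> rw [r2 _ (by decide) (by decide)] <;> assumption
  obtain ⟨r3, m3, l3⟩ := reach_run (k := 4) (r := 10) (t := sincereTop G)
    (c := insincereTop G listing) (s := s2) (v := v 0) z2
    ((r2 10 (by decide) (by decide)).trans H1.reg10) (by decide) hn
    (fun j => (m2 _ (by have := j.2; omega)).trans (H1.first j))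
    (fun j => (m2 _ (by have := j.2; omega)).trans (H1.second j))
    (fun z => (m2 _ (by omega)).trans (H1.rest _ (by omega))) h0
  set s3 := (Cmd.reach 4 10).run s2
  have z3 : Sizes n m w s3.reg := by
    obtain ⟨e1, e2, e3⟩ := z2
    constructor <;> rw [r3 _ (by decide) (by decide)] <;> assumption
  have hlow : ∀ x < 3 * w.length, s3.mem x = s1.mem x := fun x hx =>
    (m3 x (by omega)).trans (m2 x (by omega))
  have L : Layout tb (G.profile 0) (sincereTop G) (insincereTop G listing) s3.reg s3.mem := by
    refine ⟨z3.reg1, z3.reg2, fun q => ?_, fun q => ?_, fun j => ?_, fun j => ?_⟩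
    · rw [hlow _ (by have := q.2; omega), H1.tieBreaking]
    · rw [hlow _ (by have := q.2; omega), H1.sincereVote]
    · rw [z3.reg3, hlow _ (by have := j.2; omega)]
      exact H1.first j
    · rw [z3.reg3, hlow _ (by have := j.2; omega)]
      exact H1.second j
  have h9 : s3.reg 9 = (u 0 : Fin m) :=
    (r3 9 (by decide) (by decide)).trans ((r2 9 (by decide) (by decide)).trans H1.reg9)
  have h10 : s3.reg 10 = (v 0 : Fin m) :=
    (r3 10 (by decide) (by decide)).trans ((r2 10 (by decide) (by decide)).trans H1.reg10)
  have hk3 : ∀ z : Fin m, 0 < s3.mem (3 * s3.reg 3 + z) ↔ z ∈ layer (others n) (sincereTop G)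
      (insincereTop G listing) (u 0) (Fintype.card (Fin m)) := by
    intro z
    rw [z3.reg3, m3 _ (by have := z.2; omega)]
    exact l2 z
  have hk4 : ∀ z : Fin m, 0 < s3.mem (4 * s3.reg 3 + z) ↔ z ∈ layer (others n) (sincereTop G)
      (insincereTop G listing) (v 0) (Fintype.card (Fin m)) := by
    intro z
    rw [z3.reg3]
    exact l3 z
  rw [Cmd.main_run_reg_zero, Expr.eval_ind, Expr.holds_and, Expr.holds_not,
    L.holds_worseSomewhere h9 h10 (by decide) (by decide) hk3 hk4,
    L.holds_worseSomewhere h10 h9 (by decide) (by decide) hk4 hk3,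
    dominates_iff hplayer hnon]

/-- The machine program: the sizes are stored in the registers `1`, `2` and `3`. -/
def program : List Instr :=
  [.const 4 0, .plus 3 0 4, .load 1 4, .const 4 1, .load 2 4] ++ Cmd.main.code 18 5

theorem main_wf : Cmd.main.WF 18 := by
  simp [Cmd.main, Cmd.WF, Cmd.readInput, Cmd.readVoter, Cmd.readStrategy, Cmd.reach, Expr.WF,
    Expr.worseSomewhere, Expr.criterion, Expr.ex, Expr.and, Expr.or, Expr.not, Expr.lt, Expr.le,
    Expr.eq, Expr.imp, Expr.ind, Expr.countViolations, Expr.compatible, Expr.beats, Expr.rankAt,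
    Expr.tieBreaking, Expr.sincereVote, Expr.sincereLoad, Expr.countOption, Expr.countOption₂,
    Expr.isOption, Expr.firstOption, Expr.secondOption, Expr.cell]

theorem length_le_inputSize (w : List ℕ) : w.length ≤ inputSize w := by
  induction w with
  | nil => exact Nat.zero_le _
  | cons a w ih =>
    simp only [inputSize, List.map_cons, List.sum_cons, List.length_cons] at *
    omega

theorem iterate_step_of_halted {P : List Instr} {c : Config} (h : P.length ≤ c.pc) (t : ℕ) :
    (step P)^[t] c = c := by
  refine Function.iterate_fixed ?_ t
  rw [step, List.getElem?_eq_none h]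

/-- The five initial instructions fill the protected registers with `n`, `m` and the input length,
all at most `inputSize w`; this bound enters the cost polynomial. -/
theorem program_haltsWith {w : List ℕ} (hn : w.getD 0 0 ≤ w.length)
    (hm : w.getD 1 0 ≤ w.length) {out : ℕ}
    (hout : ∀ s : Store, Sizes (w.getD 0 0) (w.getD 1 0) w s.reg → (∀ x, s.mem x = w.getD x 0) →
      (Cmd.main.run s).reg 0 = out) :
    HaltsWith program w ((Cmd.main.cost + 5).eval (inputSize w)) out := by
  set c : Config := (Instr.load 2 4).exec ((Instr.const 4 1).exec ((Instr.load 1 4).exec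
    ((Instr.plus 3 0 4).exec ((Instr.const 4 0).exec (initConfig w))))) with hc
  have hcode : CodeAt program 0 program := codeAt_self [] program
  obtain ⟨⟨i0, i1, i2, i3, i4, -⟩, hmain⟩ := codeAt_append.1 hcode
  have hsizes : Sizes (w.getD 0 0) (w.getD 1 0) w c.reg := by
    constructor <;> simp [hc, Instr.exec, initConfig]
  have hmem : c.mem = fun x => w.getD x 0 := by simp [hc, Instr.exec, initConfig]
  have hle := length_le_inputSize w
  have hb : BoundedBy (inputSize w) c.reg := by
    intro b h1 h3
    obtain ⟨e1, e2, e3⟩ := hsizes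
    interval_cases b <;> omega
  obtain ⟨c', hr, hp, hv, -, -⟩ := Cmd.main.code_correct main_wf (P := program) (k := 18) (off := 5)
    le_rfl hmain c ⟨c.reg, c.mem⟩ rfl (fun _ _ => rfl) rfl hb
  have hreach : Reaches program (initConfig w) c' ((Cmd.main.cost + 5).eval (inputSize w)) := by
    refine .headAt (p := 0) rfl i0 (.headAt (p := 1) rfl i1 (.headAt (p := 2) rfl i2
      (.headAt (p := 3) rfl i3 (.headAt (p := 4) rfl i4 hr le_rfl) le_rfl) le_rfl) le_rfl) ?_
    simp only [Polynomial.eval_add, Polynomial.eval_ofNat]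
    omega
  have hhalt : program.length ≤ c'.pc := by
    rw [hp, program, List.length_append, Cmd.length_code]
    rfl
  obtain ⟨t, ht, e⟩ := hreach
  -- A halted machine does not move, so the remaining steps of the time bound change nothing.
  have hfin : (step program)^[(Cmd.main.cost + 5).eval (inputSize w)] (initConfig w) = c' := by
    rw [← Nat.sub_add_cancel ht, Function.iterate_add_apply, e, iterate_step_of_halted hhalt]
  rw [HaltsWith, hfin]
  refine ⟨hhalt, ?_⟩
  rw [hv 0 (by decide)]
  exact hout ⟨c.reg, c.mem⟩ hsizes fun x => by rw [hmem]

end Algorithm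

theorem encode_eq (I : PluralityInstance) :
    I.encode = encoding I.tb I.game.profile I.listing I.u I.v := by
  simp [PluralityInstance.encode, encoding, profileSuffix, listingSuffix]

end GSVoting

theorem theorem2 :
    GSVoting.PolyTimeDecidable GSVoting.PluralityInstance.encode
      (fun I : GSVoting.PluralityInstance => I.game.Dominates I.u I.v) := by
  classical
  refine ⟨GSVoting.program, GSVoting.Cmd.main.cost + 5, fun I => ?_⟩
  have key : GSVoting.HaltsWith GSVoting.program I.encode
      ((GSVoting.Cmd.main.cost + 5).eval (GSVoting.inputSize I.encode))
      (if I.game.Dominates I.u I.v then 1 else 0) := by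
    obtain ⟨hn, hm⟩ := GSVoting.le_length_encoding I.tb I.game.profile I.listing I.u I.v
    rw [GSVoting.encode_eq]
    refine GSVoting.program_haltsWith (w := GSVoting.encoding I.tb I.game.profile
      I.listing I.u I.v) hn (le_trans (by simp only [GSVoting.encoding, List.cons_append,
        List.nil_append, List.getD_cons_succ, List.getD_cons_zero]; omega) hm) fun s hs hmem =>
      GSVoting.main_run I.listing_player I.listing_nonplayer I.u I.v hs hmem
  exact ⟨fun h => by rwa [if_pos h] at key, fun h => by rwa [if_neg h] at key⟩
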